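/- **Theorem (Order optimality).** Let $K,N\ge 1$ be integers and $M\in[N/K,N)$ a real number. Consider $N$ files $W_1,\dots,W_N$ of $F$ bits each and $K$ users. In an *uncoded placement* $\mathcal M=(\mathcal M_1,\dots,\mathcal M_K)$, each user $k$ stores at most $MF$ of the bits of the files. For a demand vector $d=(d_1,\dots,d_K)\in[N]^K$, each user $k$ then broadcasts to all the others a codeword $X_k$ of $R_kF$ bits that is a function of its own cache content (and of $d$), and each user $k$ must recover $W_{d_k}$ without error, for every value of the files, from its cache and $(X_i)_{i\ne k}$. The load is $R=\sum_k R_k$. The delivery is *one-shot* if each user $k$ can recover every bit of $W_{d_k}$ that it has not cached from its cache and the codeword of a single other user (which may depend on the bit). Let $R^*(d,\mathcal M)$ and $R^*_{\rm o}(d,\mathcal M)$ be the minimum loads for $d$ and $\mathcal M$ without and with the one-shot constraint ($+\infty$ if no delivery works), and let $$R^*_{\rm ave}=\inf_{\mathcal M}\mathbb E_d[R^*(d,\mathcal M)],\qquad R^*_{\rm worst}=\inf_{\mathcal M}\max_d R^*(d,\mathcal M),$$ where $d$ is uniform on $[N]^K$ and the infimum is over all uncoded placements and all file lengths $F\ge1$.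 Define $R^*_{\rm ave,o}$ and $R^*_{\rm worst,o}$ likewise from $R^*_{\rm o}$. Let $N_{\rm e}(d_{\backslash\{k\}})$ be the number of distinct files requested by the users other than $k$. With $t=KM/N$, the proposed scheme has the average and worst-case loads given, for $t\in\{1,\dots,K\}$, by $$R_{\rm ave}=\mathbb E_d\left[\frac{\binom{K-1}{t}-\frac1K\sum_{k=1}^K\binom{K-1-N_{\rm e}(d_{\backslash\{k\}})}{t}}{\binom{K-1}{t-1}}\right],$$ $$R_{\rm worst}=\begin{cases}\dfrac{\binom{K-1}{t}}{\binom{K-1}{t-1}}, & K\le N,\\[2ex] \dfrac{\binom{K-1}{t}-\frac{2N-K}{K}\binom{K-N}{t}-\frac{2(K-N)}{K}\binom{K-1-N}{t}}{\binom{K-1}{t-1}}, & N<K<2N,\\[2ex] \dfrac{\binom{K-1}{t}-\binom{K-1-N}{t}}{\binom{K-1}{t-1}}, & K\ge 2N,\ K>N,\end{cases}$$ and, for non-integer $t$, by the value at $t$ of the lower convex envelope of these values at $1,\dots,K$. Then these loads are achievable with uncoded placement, even by one-shot delivery, and they are within a factor of $2$ of the optimum under uncoded placement, with the one-shot constraint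 removed: $$R^*_{\rm ave}\le R^*_{\rm ave,o}\le R_{\rm ave}\le 2R^*_{\rm ave},\qquad R^*_{\rm worst}\le R^*_{\rm worst,o}\le R_{\rm worst}\le 2R^*_{\rm worst}.$$ -/

import Mathlib

open scoped ENNReal

namespace D2DCaching

/-- A library of `N` files, each consisting of `F` bits. -/
abbrev Library (N F : ℕ) : Type := Fin N → Fin F → Bool

/-- An uncoded placement: user `k` stores the bits of the library whose positions
(file index, bit index) lie in `Z k`. -/
abbrev Placement (K N F : ℕ) : Type := Fin K → Finset (Fin N × Fin F)

/-- A demand vector: user `k` requests the file `d k`. -/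
abbrev Demand (K N : ℕ) : Type := Fin K → Fin N

/-- The content of a cache that stores the positions in `C`, for the library `W`. -/
def cacheContent {N F : ℕ} (C : Finset (Fin N × Fin F)) (W : Library N F) : C → Bool :=
  fun b => W b.1.1 b.1.2

/-- Every user has a memory of `M * F` bits. -/
def Placement.FitsMemory {K N F : ℕ} (Z : Placement K N F) (M : ℝ) : Prop :=
  ∀ k, ((Z k).card : ℝ) ≤ M * F

/-- A delivery phase: each user `k` broadcasts `len k` bits, computed from its own cache. -/
structure Delivery {K N F : ℕ} (Z : Placement K N F) where
  len : Fin K → ℕ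
  enc : ∀ k, (Z k → Bool) → (Fin (len k) → Bool)

namespace Delivery

variable {K N F : ℕ} {Z : Placement K N F}

/-- The codeword broadcast by user `i`, for the library `W`. -/
def codeword (X : Delivery Z) (W : Library N F) (i : Fin K) : Fin (X.len i) → Bool :=
  X.enc i (cacheContent (Z i) W)

/-- Every user recovers its requested file from its cache and the codewords of all the other
users, whatever the library is. -/
def Decodes (X : Delivery Z) (d : Demand K N) : Prop :=
  ∀ k, ∃ dec : (Z k → Bool) → (∀ i : {i : Fin K // i ≠ k}, Fin (X.len i) → Bool) →
      (Fin F → Bool),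
    ∀ W : Library N F, dec (cacheContent (Z k) W) (fun i => X.codeword W i) = W (d k)

/-- Every user recovers any bit of its requested file that it has not cached from its cache and
the codeword of a single other user. -/
def OneShot (X : Delivery Z) (d : Demand K N) : Prop :=
  ∀ k, ∀ b : Fin F, (d k, b) ∉ Z k → ∃ i, i ≠ k ∧
    ∃ dec : (Z k → Bool) → (Fin (X.len i) → Bool) → Bool,
      ∀ W : Library N F, dec (cacheContent (Z k) W) (X.codeword W i) = W (d k) b

/-- The sum-load: the total number of broadcast bits, in units of the file length. -/
noncomputable def load (X : Delivery Z) : ℝ≥0∞ :=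
  ((∑ k, X.len k : ℕ) : ℝ≥0∞) / (F : ℝ≥0∞)

end Delivery

/-- The minimum load for demand `d` and placement `Z`; it is `∞` if no delivery works. -/
noncomputable def minLoad {K N F : ℕ} (Z : Placement K N F) (d : Demand K N) : ℝ≥0∞ :=
  ⨅ (X : Delivery Z) (_ : X.Decodes d), X.load

/-- The minimum load for demand `d` and placement `Z` under one-shot delivery. -/
noncomputable def minLoadOneShot {K N F : ℕ} (Z : Placement K N F) (d : Demand K N) : ℝ≥0∞ :=
  ⨅ (X : Delivery Z) (_ : X.Decodes d ∧ X.OneShot d), X.load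

/-- The minimum, over all file lengths and all uncoded placements, of the expected load for a
uniformly distributed demand vector. -/
noncomputable def optAve (K N : ℕ) (M : ℝ) : ℝ≥0∞ :=
  ⨅ (F : ℕ) (_ : 0 < F) (Z : Placement K N F) (_ : Z.FitsMemory M),
    (∑ d : Demand K N, minLoad Z d) / ((N : ℝ≥0∞) ^ K)

/-- The minimum, over all file lengths and all uncoded placements, of the largest load over all
demand vectors. -/
noncomputable def optWorst (K N : ℕ) (M : ℝ) : ℝ≥0∞ :=
  ⨅ (F : ℕ) (_ : 0 < F) (Z : Placement K N F) (_ : Z.FitsMemory M),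
    ⨆ d : Demand K N, minLoad Z d

/-- As `optAve`, under the constraint of one-shot delivery. -/
noncomputable def optAveOneShot (K N : ℕ) (M : ℝ) : ℝ≥0∞ :=
  ⨅ (F : ℕ) (_ : 0 < F) (Z : Placement K N F) (_ : Z.FitsMemory M),
    (∑ d : Demand K N, minLoadOneShot Z d) / ((N : ℝ≥0∞) ^ K)

/-- As `optWorst`, under the constraint of one-shot delivery. -/
noncomputable def optWorstOneShot (K N : ℕ) (M : ℝ) : ℝ≥0∞ :=
  ⨅ (F : ℕ) (_ : 0 < F) (Z : Placement K N F) (_ : Z.FitsMemory M),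
    ⨆ d : Demand K N, minLoadOneShot Z d

/-- The number of distinct files requested by all the users but user `k`. -/
def numDistinctExcept {K N : ℕ} (d : Demand K N) (k : Fin K) : ℕ :=
  ((Finset.univ.erase k).image d).card

/-- The load of the proposed scheme for the demand `d`, when `t = K * M / N` is a positive
integer. The number of distinct requests of `K - 1` users is at most `K - 1`, so the natural
subtractions are exact. -/
noncomputable def schemeLoad {K N : ℕ} (d : Demand K N) (t : ℕ) : ℝ :=
  (((K - 1).choose t : ℝ)
      - (1 / (K : ℝ)) * ∑ k, ((K - 1 - numDistinctExcept d k).choose t : ℝ))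
    / ((K - 1).choose (t - 1) : ℝ)

/-- The average load of the proposed scheme at an integer `t`. -/
noncomputable def schemeAveAt (K N t : ℕ) : ℝ :=
  (∑ d : Demand K N, schemeLoad d t) / (N : ℝ) ^ K

/-- The worst-case load of the proposed scheme at an integer `t`. -/
noncomputable def schemeWorstAt (K N t : ℕ) : ℝ :=
  if K ≤ N then
    ((K - 1).choose t : ℝ) / ((K - 1).choose (t - 1) : ℝ)
  else if 2 * N ≤ K then
    (((K - 1).choose t : ℝ) - ((K - 1 - N).choose t : ℝ)) / ((K - 1).choose (t - 1) : ℝ)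
  else
    (((K - 1).choose t : ℝ)
        - (2 * (N : ℝ) - K) / K * ((K - N).choose t : ℝ)
        - 2 * ((K : ℝ) - N) / K * ((K - 1 - N).choose t : ℝ))
      / ((K - 1).choose (t - 1) : ℝ)

/-- The value at `x` of the lower convex envelope of the points `(t, r t)`, `t = 1, …, K`: the
least ordinate of a convex combination of these points that has abscissa `x`. -/
noncomputable def lowerConvexEnvelope (K : ℕ) (r : ℕ → ℝ) (x : ℝ) : ℝ :=
  sInf {y : ℝ | ∃ w : ℕ → ℝ, (∀ t ∈ Finset.Icc 1 K, 0 ≤ w t) ∧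
    ∑ t ∈ Finset.Icc 1 K, w t = 1 ∧
    ∑ t ∈ Finset.Icc 1 K, w t * (t : ℝ) = x ∧
    y = ∑ t ∈ Finset.Icc 1 K, w t * r t}

open Classical in
/-- The extension of `r` from the integers `1, …, K` to real arguments: the given value at an
integer, the lower convex envelope elsewhere. -/
noncomputable def extendByEnvelope (K : ℕ) (r : ℕ → ℝ) (x : ℝ) : ℝ :=
  if x = (⌊x⌋₊ : ℝ) then r ⌊x⌋₊ else lowerConvexEnvelope K r x

/-- The average load of the proposed scheme with memory size `M`. -/
noncomputable def schemeAve (K N : ℕ) (M : ℝ) : ℝ :=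
  extendByEnvelope K (schemeAveAt K N) (K * M / N)

/-- The worst-case load of the proposed scheme with memory size `M`. -/
noncomputable def schemeWorst (K N : ℕ) (M : ℝ) : ℝ :=
  extendByEnvelope K (schemeWorstAt K N) (K * M / N)

end D2DCaching

namespace D2DCaching

open Finset

/-! Achievability. For an integer `t`, each file is split into symbols labelled by a sender `j` and
a set `T` of `t - 1` other users; `j` and the users in `T` cache the symbol. User `j` then acts as a
server for the other `K - 1` users: it sends the XOR messages of those `t`-sets that meet a set of
leaders, one user for each file requested by the others. The messages of the leaderless sets follow
from these (`multicast_eq_of_leaders`), and each missing bit comes from a single sender, so the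
delivery is one-shot (`exists_placement`). Memory sharing in rational proportions realises convex
combinations up to any ε (`exists_placement_approx`), which the infimum absorbs.

Converse. The joint codewords can be viewed as one server message, so the acyclic index coding bound
applies (`Delivery.Decodes.acyclic_bound`). After averaging over permutations of the users and
shifts of the files, a placement matters only through the distribution of the number `s` of holders
of a bit. For `m` distinct requests the bound is the mean of `cutLoad K m s`, which is convex and
nonincreasing in `s`, while the memory constraint bounds the mean of `s` by `K * M / N`.

Comparison. By binomial identities the scheme costs at most `(t + 1) / t ≤ 2` times `cutLoad` at
each integer `t ≥ 1` (`scheme_le_two_mul_cutLoad`). `extendByEnvelope_le` carries the factor over to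
the distribution of `s` and to non-integer `K * M / N`. -/

/-! ### Linear relations among the multicast messages -/

/-- The coded multicast message for the user set `B`: the sum over the users `k ∈ B` of the
symbol wanted by `k` and cached by the other users of `B`. -/
def multicast {α β R : Type*} [DecidableEq α] [AddCommMonoid R] (d : α → β)
    (Y : β → Finset α → R) (B : Finset α) : R :=
  ∑ k ∈ B, Y (d k) (B.erase k)

/-- The sets of users in `C` whose requests are distinct and exhaust the requests of `U`. -/
def leaderSets {α β : Type*} [DecidableEq α] [DecidableEq β] (d : α → β) (U C : Finset α) :
    Finset (Finset α) :=
  C.powerset.filter fun V => V.image d = U.image d ∧ V.card = U.card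

theorem injOn_of_mem_leaderSets {α β : Type*} [DecidableEq α] [DecidableEq β] {d : α → β}
    {U C V : Finset α} (hU : Set.InjOn d U) (hV : V ∈ leaderSets d U C) : Set.InjOn d V := by
  simp only [leaderSets, mem_filter] at hV
  apply Finset.card_image_iff.mp
  rw [hV.2.1, hV.2.2, Finset.card_image_iff.mpr hU]

/-- Over a ring of characteristic two, the multicast messages of the complements of all leader
sets sum to zero. -/
theorem sum_multicast_leaderSets {α β R : Type*} [DecidableEq α] [DecidableEq β]
    [AddCommMonoid R] (hR : ∀ x : R, x + x = 0) (d : α → β) (Y : β → Finset α → R)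
    (U C : Finset α) (hU : Set.InjOn d U) (hC : C.image d ⊆ U.image d) :
    ∑ V ∈ leaderSets d U C, multicast d Y (C \ V) = 0 := by
  classical
  unfold multicast
  rw [Finset.sum_sigma']
  have key : ∀ p : (Σ _ : Finset α, α), ∃ k', p ∈ (leaderSets d U C).sigma (fun V => C \ V) →
      k' ∈ p.1 ∧ d k' = d p.2 := by
    rintro ⟨V, k⟩
    by_cases hp : (⟨V, k⟩ : Σ _ : Finset α, α) ∈ (leaderSets d U C).sigma (fun V => C \ V)
    · have hp' := hp
      simp only [mem_sigma, leaderSets, mem_filter, mem_sdiff] at hp'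
      have : d k ∈ V.image d := by
        rw [hp'.1.2.1]; exact hC (mem_image_of_mem _ hp'.2.1)
      obtain ⟨k', h1, h2⟩ := mem_image.mp this
      exact ⟨k', fun _ => ⟨h1, h2⟩⟩
    · exact ⟨k, fun h => absurd h hp⟩
  choose κ hκ using key
  have hswap : ∀ V k, (⟨V, k⟩ : Σ _ : Finset α, α) ∈
      (leaderSets d U C).sigma (fun V => C \ V) →
      (⟨insert k (V.erase (κ ⟨V, k⟩)), κ ⟨V, k⟩⟩ : Σ _ : Finset α, α) ∈
        (leaderSets d U C).sigma (fun V => C \ V) := by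
    intro V k hp
    obtain ⟨h1, h2⟩ := hκ _ hp
    simp only [mem_sigma, mem_sdiff, leaderSets, mem_filter, mem_powerset] at hp ⊢
    obtain ⟨⟨hVC, hVi, hVc⟩, hkC, hkV⟩ := hp
    simp only at h1 h2
    refine ⟨⟨?_, ?_, ?_⟩, hVC h1, ?_⟩
    · intro x hx
      simp only [mem_insert, mem_erase] at hx
      grind
    · rw [← hVi]
      ext y
      simp only [mem_image, mem_insert, mem_erase]
      grind
    · rw [card_insert_of_notMem (by simp [hkV]), card_erase_of_mem h1, ← hVc]
      have := card_pos.mpr ⟨_, h1⟩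
      omega
    · simp only [mem_insert, mem_erase]
      grind
  -- The involution exchanges `k` with the member `κ` of `V` that requests the same file. Neither
  -- that file nor the set `(C \ V).erase k` changes, so the two terms are equal and cancel in
  -- characteristic two.
  refine Finset.sum_involution (fun p _ => ⟨insert p.2 (p.1.erase (κ p)), κ p⟩) ?_ ?_
    (fun p hp => hswap p.1 p.2 hp) ?_
  · rintro ⟨V, k⟩ hp
    obtain ⟨h1, h2⟩ := hκ _ hp
    simp only [mem_sigma, mem_sdiff] at hp
    simp only at h1 h2 ⊢
    have : (C \ insert k (V.erase (κ ⟨V, k⟩))).erase (κ ⟨V, k⟩) = (C \ V).erase k := by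
      ext x; simp only [mem_erase, mem_sdiff, mem_insert]
      grind
    rw [this, h2]; exact hR _
  · rintro ⟨V, k⟩ hp _ h
    have h1 := (hκ _ hp).1
    simp only [mem_sigma, mem_sdiff] at hp
    have : κ ⟨V, k⟩ = k := (Sigma.mk.inj_iff.mp h).2.eq
    simp only [this] at h1
    exact hp.2.2 h1
  · rintro ⟨V, k⟩ hp
    obtain ⟨h1, h2⟩ := hκ _ hp
    have hmem := hswap V k hp
    obtain ⟨h3, h4⟩ := hκ _ hmem
    have hinj := injOn_of_mem_leaderSets hU (mem_sigma.mp hmem).1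
    have hback : κ ⟨insert k (V.erase (κ ⟨V, k⟩)), κ ⟨V, k⟩⟩ = k := by
      apply hinj h3 (by simp)
      rw [h4]; exact h2
    simp only [mem_sigma, mem_sdiff] at hp
    simp only [hback]
    congr 1
    simp only at h1
    ext x; simp only [mem_erase, mem_insert]
    grind

/-- The multicast message of a set without leaders is determined by those of the sets of the
same size that contain a leader. -/
theorem multicast_eq_of_leaders {α β R : Type*} [DecidableEq α] [DecidableEq β]
    [AddCommGroup R] (hR : ∀ x : R, x + x = 0) (d : α → β) (Y Y' : β → Finset α → R)
    (U E : Finset α) (hUE : U ⊆ E) (hU : Set.InjOn d U) (hE : E.image d ⊆ U.image d)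
    (B : Finset α) (hB : B ⊆ E)
    (h : ∀ B' ⊆ E, B'.card = B.card → ¬ Disjoint B' U → multicast d Y B' = multicast d Y' B') :
    multicast d Y B = multicast d Y' B := by
  by_cases hd : Disjoint B U
  swap
  · exact h B hB rfl hd
  have hCE : B ∪ U ⊆ E := union_subset hB hUE
  have hC : (B ∪ U).image d ⊆ U.image d := (image_subset_image hCE).trans hE
  have hUm : U ∈ leaderSets d U (B ∪ U) := by
    simp only [leaderSets, mem_filter, mem_powerset, subset_union_right, and_self]
  have hBU : (B ∪ U) \ U = B := by
    rw [union_sdiff_right, sdiff_eq_self_of_disjoint hd]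
  have e1 := sum_multicast_leaderSets hR d Y U _ hU hC
  have e2 := sum_multicast_leaderSets hR d Y' U _ hU hC
  rw [← Finset.add_sum_erase _ _ hUm, hBU] at e1 e2
  -- A leader set `V ≠ U` has the size of `U`, so it misses an element of `U`. Hence `(B ∪ U) \ V`
  -- meets `U`, has the size of `B`, and its message is known.
  have : ∑ V ∈ (leaderSets d U (B ∪ U)).erase U, multicast d Y ((B ∪ U) \ V) =
      ∑ V ∈ (leaderSets d U (B ∪ U)).erase U, multicast d Y' ((B ∪ U) \ V) := by
    refine Finset.sum_congr rfl fun V hV => ?_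
    simp only [leaderSets, mem_erase, mem_filter, mem_powerset] at hV
    obtain ⟨hne, hVC, -, hVc⟩ := hV
    refine h _ (sdiff_subset.trans hCE) ?_ ?_
    · rw [card_sdiff_of_subset hVC, hVc, card_union_of_disjoint hd]; omega
    · intro hdis
      apply hne
      have : U ⊆ V := by
        intro x hx
        by_contra hxV
        exact Finset.disjoint_left.mp hdis (by simp [hx, hxV]) hx
      exact (Finset.eq_of_subset_of_card_le this hVc.le).symm
  rw [this] at e1
  exact add_right_cancel (e1.trans e2.symm)

/-! ### Decoders from determinacy -/

theorem Delivery.OneShot.decodes {K N F : ℕ} {Z : Placement K N F} {X : Delivery Z}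
    {d : Demand K N} (h : X.OneShot d) : X.Decodes d := by
  classical
  intro k
  have h' : ∀ b : Fin F, ∃ dec : (Z k → Bool) →
      (∀ i : {i : Fin K // i ≠ k}, Fin (X.len i) → Bool) → Bool,
      ∀ W : Library N F, dec (cacheContent (Z k) W) (fun i => X.codeword W i) = W (d k) b := by
    intro b
    by_cases hb : (d k, b) ∈ Z k
    · exact ⟨fun c _ => c ⟨_, hb⟩, fun W => rfl⟩
    · obtain ⟨i, hi, dec, hdec⟩ := h k b hb
      exact ⟨fun c y => dec c (y ⟨i, hi⟩), hdec⟩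
  choose dec hdec using h'
  exact ⟨fun c y b => dec b c y, fun W => funext fun b => hdec b W⟩

/-- A criterion for one-shot delivery in terms of the information that determines a bit. -/
theorem minLoadOneShot_le {K N F : ℕ} (Z : Placement K N F) (d : Demand K N)
    (C : Fin K → Type) [∀ j, Fintype (C j)] (X : ∀ j, Library N F → C j → Bool)
    (hX : ∀ j W W', (∀ p ∈ Z j, W p.1 p.2 = W' p.1 p.2) → X j W = X j W')
    (hdec : ∀ k b, (d k, b) ∉ Z k → ∃ i, i ≠ k ∧ ∀ W W',
      (∀ p ∈ Z k, W p.1 p.2 = W' p.1 p.2) → X i W = X i W' → W (d k) b = W' (d k) b) :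
    minLoadOneShot Z d ≤ ((∑ j, Fintype.card (C j) : ℕ) : ℝ≥0∞) / (F : ℝ≥0∞) := by
  classical
  -- The value `false` at uncached positions is harmless, since `X j` depends only on the bits
  -- cached by `j`.
  let ext : ∀ j, (Z j → Bool) → Library N F := fun j c n b =>
    if h : (n, b) ∈ Z j then c ⟨_, h⟩ else false
  let D : Delivery Z :=
    { len := fun j => Fintype.card (C j)
      enc := fun j c i => X j (ext j c) ((Fintype.equivFin (C j)).symm i) }
  have hcw : ∀ W j, D.codeword W j = fun i => X j W ((Fintype.equivFin (C j)).symm i) := by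
    intro W j
    funext i
    change X j (ext j (cacheContent (Z j) W)) _ = _
    rw [hX j (ext j (cacheContent (Z j) W)) W]
    intro p hp
    change (if h : (p.1, p.2) ∈ Z j then _ else _) = _
    rw [dif_pos hp]; rfl
  have hone : D.OneShot d := by
    intro k b hb
    obtain ⟨i, hi, hdet⟩ := hdec k b hb
    refine ⟨i, hi, ?_⟩
    let g : Library N F → (Z k → Bool) × (Fin (D.len i) → Bool) := fun W =>
      (cacheContent (Z k) W, D.codeword W i)
    have hfac : Function.FactorsThrough (fun W : Library N F => W (d k) b) g := by
      intro W W' hg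
      have h1 : cacheContent (Z k) W = cacheContent (Z k) W' := congrArg Prod.fst hg
      have h2 : D.codeword W i = D.codeword W' i := congrArg Prod.snd hg
      refine hdet W W' (fun p hp => congrFun h1 ⟨p, hp⟩) ?_
      rw [hcw, hcw] at h2
      funext c
      have := congrFun h2 (Fintype.equivFin (C i) c)
      simpa using this
    refine ⟨fun c y => Function.extend g (fun W => W (d k) b) (fun _ => false) (c, y), ?_⟩
    intro W
    exact hfac.extend_apply _ W
  exact iInf₂_le_of_le D ⟨hone.decodes, hone⟩ le_rfl

/-! ### Counting messages and symbols -/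

theorem card_filter_mem_powersetCard {α : Type*} [DecidableEq α] (E U : Finset α) (hU : U ⊆ E)
    (s : ℕ) : ((E.powersetCard s).filter fun B => ¬ Disjoint B U).card
      = E.card.choose s - (E.card - U.card).choose s := by
  have h1 : (E.powersetCard s).filter (fun B => Disjoint B U) = (E \ U).powersetCard s := by
    ext B
    simp only [mem_filter, mem_powersetCard, subset_sdiff]
    tauto
  have h2 := Finset.card_filter_add_card_filter_not (s := E.powersetCard s) (fun B => Disjoint B U)
  rw [h1, card_powersetCard, card_powersetCard, card_sdiff_of_subset hU] at h2
  omega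

theorem exists_leaders {α β : Type*} [DecidableEq β] (d : α → β)
    (E : Finset α) : ∃ U ⊆ E, Set.InjOn d U ∧ U.image d = E.image d := by
  obtain ⟨U, hU, h1, h2⟩ := Finset.exists_subset_injOn_image_eq_of_surjOn (f := d) (E : Set α)
    (E.image d) (by rw [coe_image]; exact Set.surjOn_image _ _)
  exact ⟨U, by exact_mod_cast hU, h1, h2⟩

/-- The labels `(a, j, T)` of the symbols of a file: in the copy `a` of the scheme with parameter
`s a`, the symbol is sent by user `j` and also cached by the users in `T`. -/
def labels {A : Type} [Fintype A] (K : ℕ) (s : A → ℕ) : Finset (A × Fin K × Finset (Fin K)) := by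
  classical
  exact univ.filter fun l => l.2.1 ∉ l.2.2 ∧ l.2.2.card + 1 = s l.1

theorem card_sets_avoiding {K : ℕ} (j : Fin K) (s : ℕ) (hs : 1 ≤ s) :
    (univ.filter fun T : Finset (Fin K) => j ∉ T ∧ T.card + 1 = s).card
      = (K - 1).choose (s - 1) := by
  have : (univ.filter fun T : Finset (Fin K) => j ∉ T ∧ T.card + 1 = s)
      = (univ.erase j).powersetCard (s - 1) := by
    ext T
    simp only [mem_filter, mem_univ, true_and, mem_powersetCard, subset_erase, subset_univ]
    have : T.card + 1 = s ↔ T.card = s - 1 := by omega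
    rw [this]
  rw [this, card_powersetCard, card_erase_of_mem (mem_univ _), card_fin]

theorem card_sets_avoiding_two {K : ℕ} (j k : Fin K) (hjk : j ≠ k) (s : ℕ) (hs : 1 ≤ s) :
    (univ.filter fun T : Finset (Fin K) =>
      (j ∉ T ∧ T.card + 1 = s) ∧ ¬ (k = j ∨ k ∈ T)).card = (K - 2).choose (s - 1) := by
  have : (univ.filter fun T : Finset (Fin K) => (j ∉ T ∧ T.card + 1 = s) ∧ ¬ (k = j ∨ k ∈ T))
      = ((univ.erase j).erase k).powersetCard (s - 1) := by
    ext T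
    simp only [mem_filter, mem_univ, true_and, mem_powersetCard, subset_erase, subset_univ]
    have : T.card + 1 = s ↔ T.card = s - 1 := by omega
    rw [this]
    have := hjk.symm
    tauto
  rw [this, card_powersetCard, card_erase_of_mem (by simp [hjk.symm]),
    card_erase_of_mem (mem_univ _), card_fin, Nat.sub_sub]

theorem card_labels_eq {A : Type} [Fintype A] (K : ℕ) (s : A → ℕ)
    (P : Fin K → Finset (Fin K) → Prop) [∀ j T, Decidable (P j T)] :
    ((labels K s).filter fun l => P l.2.1 l.2.2).card
      = ∑ a, ∑ j, (univ.filter fun T : Finset (Fin K) =>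
          (j ∉ T ∧ T.card + 1 = s a) ∧ P j T).card := by
  classical
  unfold labels
  rw [filter_filter, card_filter, Fintype.sum_prod_type]
  refine sum_congr rfl fun a _ => ?_
  rw [Fintype.sum_prod_type]
  refine sum_congr rfl fun j _ => ?_
  rw [card_filter]

theorem card_labels {A : Type} [Fintype A] (K : ℕ) (s : A → ℕ) (hs : ∀ a, 1 ≤ s a) :
    (labels K s).card = ∑ a, K * (K - 1).choose (s a - 1) := by
  have := card_labels_eq K s (fun _ _ => True)
  rw [filter_true] at this
  rw [this]
  refine sum_congr rfl fun a _ => ?_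
  simp only [and_true, card_sets_avoiding _ _ (hs a), sum_const, card_univ, Fintype.card_fin,
    smul_eq_mul]

/-- Count the complement: user `k` misses the symbols with sender `j ≠ k` and `T` avoiding both, and
`(K - 1) * (K - 2).choose (s - 1) = (K - s) * (K - 1).choose (s - 1)`. A copy with parameter `s`
thus puts the fraction `s / K` into each cache. -/
theorem card_labels_cached {A : Type} [Fintype A] (K : ℕ) (s : A → ℕ) (hs : ∀ a, 1 ≤ s a)
    (hsK : ∀ a, s a ≤ K) (k : Fin K) :
    ((labels K s).filter fun l => k = l.2.1 ∨ k ∈ l.2.2).card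
      = ∑ a, s a * (K - 1).choose (s a - 1) := by
  classical
  have h1 := card_labels_eq K s (fun j T => k = j ∨ k ∈ T)
  rw [h1]
  refine sum_congr rfl fun a _ => ?_
  have hK : 0 < K := k.pos
  have h2 : ∀ j : Fin K, (univ.filter fun T : Finset (Fin K) =>
      (j ∉ T ∧ T.card + 1 = s a) ∧ (k = j ∨ k ∈ T)).card + (univ.filter fun T : Finset (Fin K) =>
      (j ∉ T ∧ T.card + 1 = s a) ∧ ¬ (k = j ∨ k ∈ T)).card = (K - 1).choose (s a - 1) := by
    intro j
    rw [← card_sets_avoiding j (s a) (hs a),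
      ← filter_filter (fun T : Finset (Fin K) => j ∉ T ∧ T.card + 1 = s a) (fun T => k = j ∨ k ∈ T),
      ← filter_filter (fun T : Finset (Fin K) => j ∉ T ∧ T.card + 1 = s a)
        (fun T => ¬ (k = j ∨ k ∈ T)), card_filter_add_card_filter_not]
  have h3 := Finset.sum_congr (rfl : (univ : Finset (Fin K)) = univ) (fun j _ => h2 j)
  rw [sum_add_distrib, sum_const, card_univ, Fintype.card_fin, smul_eq_mul] at h3
  have h4 : ∑ j : Fin K, (univ.filter fun T : Finset (Fin K) =>
      (j ∉ T ∧ T.card + 1 = s a) ∧ ¬ (k = j ∨ k ∈ T)).card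
      = (K - 1) * (K - 2).choose (s a - 1) := by
    rw [← add_sum_erase _ _ (mem_univ k)]
    have : (univ.filter fun T : Finset (Fin K) =>
      (k ∉ T ∧ T.card + 1 = s a) ∧ ¬ (k = k ∨ k ∈ T)) = ∅ := by simp
    rw [this, card_empty, zero_add, sum_congr rfl fun j hj =>
      card_sets_avoiding_two j k (ne_of_mem_erase hj) (s a) (hs a), sum_const,
      card_erase_of_mem (mem_univ k), card_fin, smul_eq_mul]
  have h5 : (K - 1) * (K - 2).choose (s a - 1) = (K - s a) * (K - 1).choose (s a - 1) := by
    obtain ⟨n, rfl⟩ : ∃ n, K = n + 1 := ⟨K - 1, by omega⟩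
    rcases n with _ | n
    · have := hs a; have := hsK a
      have : s a = 1 := by omega
      simp [this]
    · have := Nat.choose_mul_succ_eq n (s a - 1)
      have e : n + 1 - (s a - 1) = n + 1 + 1 - s a := by have := hs a; omega
      rw [e] at this
      simp only [Nat.add_sub_cancel]
      rw [show n + 1 + 1 - 2 = n by omega, mul_comm, this, mul_comm]
  rw [h4, h5] at h3
  have h6 : K * (K - 1).choose (s a - 1)
      = s a * (K - 1).choose (s a - 1) + (K - s a) * (K - 1).choose (s a - 1) := by
    rw [← add_mul, Nat.add_sub_cancel' (hsK a)]
  omega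

/-! ### The scheme, with several integer parameters side by side -/

/-- Bits are identified with labels `(a, j, T)`. For the symbols labelled `j`, user `j` sends the
messages of the `s a`-subsets of the other users that meet its leader set `U j`; the leaderless ones
account for the subtracted binomial. -/
theorem exists_placement {A : Type} [Fintype A] (K N F : ℕ) (s : A → ℕ) (hs : ∀ a, 1 ≤ s a)
    (hsK : ∀ a, s a ≤ K) (hF : F = ∑ a, K * (K - 1).choose (s a - 1)) :
    ∃ Z : Placement K N F, (∀ k, (Z k).card = N * ∑ a, s a * (K - 1).choose (s a - 1)) ∧
      ∀ d, minLoadOneShot Z d ≤ ((∑ j, ∑ a, ((K - 1).choose (s a) -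
        (K - 1 - numDistinctExcept d j).choose (s a)) : ℕ) : ℝ≥0∞) / (F : ℝ≥0∞) := by
  classical
  have hcard : Fintype.card (Fin F) = Fintype.card (labels K s) := by
    rw [Fintype.card_fin, Fintype.card_coe, card_labels K s hs, hF]
  let e : Fin F ≃ labels K s := Fintype.equivOfCardEq hcard
  let Z : Placement K N F := fun k => univ.filter fun p =>
    k = (e p.2).1.2.1 ∨ k ∈ (e p.2).1.2.2
  have memZ : ∀ k p, p ∈ Z k ↔ (k = (e p.2).1.2.1 ∨ k ∈ (e p.2).1.2.2) := by
    intro k p; simp [Z]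
  refine ⟨Z, fun k => ?_, fun d => ?_⟩
  · have h1 : Z k = (univ : Finset (Fin N)) ×ˢ (univ.filter fun b : Fin F =>
        k = (e b).1.2.1 ∨ k ∈ (e b).1.2.2) := by
      ext p; simp [Z]
    have h2 : (univ.filter fun b : Fin F => k = (e b).1.2.1 ∨ k ∈ (e b).1.2.2).card
        = ((labels K s).filter fun l => k = l.2.1 ∨ k ∈ l.2.2).card := by
      refine card_bij (fun b _ => (e b).1) ?_ ?_ ?_
      · intro b hb
        simp only [mem_filter, mem_univ, true_and] at hb ⊢
        exact ⟨(e b).2, hb⟩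
      · intro b _ b' _ h
        exact e.injective (Subtype.ext h)
      · intro l hl
        simp only [mem_filter] at hl
        refine ⟨e.symm ⟨l, hl.1⟩, ?_, by simp⟩
        simpa using hl.2
    rw [h1, card_product, h2, card_labels_cached K s hs hsK, card_univ, Fintype.card_fin]
  · choose U hUE hUinj hUim using fun j : Fin K => exists_leaders d (univ.erase j)
    let C : Fin K → Type := fun j =>
      Σ a, {B // B ∈ ((univ.erase j).powersetCard (s a)).filter fun B => ¬ Disjoint B (U j)}
    -- The default `0` never enters a message: if `B` avoids `j` and has `s a` elements, every `(a,
    -- j, B.erase k)` with `k ∈ B` is a label.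
    let Y : Library N F → A → Fin K → Fin N → Finset (Fin K) → Bool := fun W a j n T =>
      if h : (a, j, T) ∈ labels K s then W n (e.symm ⟨(a, j, T), h⟩) else 0
    let X : ∀ j, Library N F → C j → Bool := fun j W c => multicast d (Y W c.1 j) c.2.1
    have hY : ∀ W W' : Library N F, ∀ k a j n T, (∀ p ∈ Z k, W p.1 p.2 = W' p.1 p.2) →
        (k = j ∨ k ∈ T) → Y W a j n T = Y W' a j n T := by
      intro W W' k a j n T hW hk
      by_cases h : (a, j, T) ∈ labels K s
      · simp only [Y, dif_pos h]
        refine hW (n, _) ((memZ _ _).mpr ?_)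
        simpa using hk
      · simp only [Y, dif_neg h]
    have hcardC : ∀ j, Fintype.card (C j) = ∑ a, ((K - 1).choose (s a) -
        (K - 1 - numDistinctExcept d j).choose (s a)) := by
      intro j
      simp only [C, Fintype.card_sigma, Fintype.card_coe]
      refine sum_congr rfl fun a _ => ?_
      rw [card_filter_mem_powersetCard _ _ (hUE j), card_erase_of_mem (mem_univ j), card_fin]
      unfold numDistinctExcept
      rw [← hUim j, card_image_of_injOn (hUinj j)]
    simp only [← hcardC]
    refine minLoadOneShot_le Z d C X ?_ ?_
    · intro j W W' h
      funext c
      simp only [X, multicast]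
      exact sum_congr rfl fun k _ => hY W W' j _ _ _ _ h (Or.inl rfl)
    · intro k b hb
      rcases hlab : e b with ⟨⟨a, j, T⟩, hl⟩
      have hb' : ¬ (k = j ∨ k ∈ T) := by
        have := (memZ k (d k, b)).not.mp hb
        simpa [hlab] using this
      push Not at hb'
      obtain ⟨hkj, hkT⟩ := hb'
      refine ⟨j, hkj.symm, fun W W' hW hXW => ?_⟩
      have hl' : j ∉ T ∧ T.card + 1 = s a := by simpa [labels] using hl
      have hBE : insert k T ⊆ univ.erase j := by
        intro x hx
        simp only [mem_insert, mem_erase, mem_univ, and_true] at hx ⊢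
        rintro rfl
        rcases hx with rfl | hx
        · exact hkj rfl
        · exact hl'.1 hx
      have hBc : (insert k T).card = s a := by rw [card_insert_of_notMem hkT, hl'.2]
      have hmc : multicast d (Y W a j) (insert k T) = multicast d (Y W' a j) (insert k T) := by
        refine multicast_eq_of_leaders (fun x : Bool => by cases x <;> rfl) d _ _ (U j)
          (univ.erase j) (hUE j) (hUinj j) (hUim j).ge _ hBE ?_
        intro B' hB'E hB'c hB'U
        exact congrFun hXW ⟨a, B', by
          simp only [mem_filter, mem_powersetCard]
          exact ⟨⟨hB'E, hB'c.trans hBc⟩, hB'U⟩⟩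
      unfold multicast at hmc
      rw [sum_insert hkT, sum_insert hkT, erase_insert hkT] at hmc
      -- Every other summand has `k` in its set, so `k` has cached it and can cancel it.
      have hrest : ∑ x ∈ T, Y W a j (d x) ((insert k T).erase x)
          = ∑ x ∈ T, Y W' a j (d x) ((insert k T).erase x) := by
        refine sum_congr rfl fun x hx => hY W W' k _ _ _ _ hW (Or.inr ?_)
        simp only [mem_erase, mem_insert, true_or, and_true]
        rintro rfl
        exact hkT hx
      rw [hrest] at hmc
      have hfin := add_right_cancel hmc
      have hbe : e.symm ⟨(a, j, T), hl⟩ = b := by rw [← hlab, Equiv.symm_apply_apply]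
      simpa only [Y, dif_pos hl, hbe] using hfin

/-! ### Memory sharing -/

theorem mul_schemeLoad {K N : ℕ} (hK : 0 < K) (d : Demand K N) (s : ℕ) (hs : s ∈ Icc 1 K) :
    (K : ℝ) * ((K - 1).choose (s - 1) : ℝ) * schemeLoad d s
      = ((∑ j, ((K - 1).choose s - (K - 1 - numDistinctExcept d j).choose s) : ℕ) : ℝ) := by
  rw [mem_Icc] at hs
  have hc : ((K - 1).choose (s - 1) : ℝ) ≠ 0 := by
    have := Nat.choose_pos (n := K - 1) (k := s - 1) (by omega)
    positivity
  have hK' : (K : ℝ) ≠ 0 := by positivity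
  have h : ∀ j, (((K - 1).choose s - (K - 1 - numDistinctExcept d j).choose s : ℕ) : ℝ)
      = ((K - 1).choose s : ℝ) - ((K - 1 - numDistinctExcept d j).choose s : ℝ) := fun j =>
    Nat.cast_sub (Nat.choose_le_choose _ (Nat.sub_le _ _))
  rw [Nat.cast_sum, sum_congr rfl fun j _ => h j, sum_sub_distrib, sum_const, card_univ,
    Fintype.card_fin, nsmul_eq_mul]
  unfold schemeLoad
  field_simp

theorem schemeLoad_nonneg {K N : ℕ} (hK : 0 < K) (d : Demand K N) (s : ℕ) (hs : s ∈ Icc 1 K) :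
    0 ≤ schemeLoad d s := by
  have h := mul_schemeLoad hK d s hs
  rw [mem_Icc] at hs
  have hc : 0 < ((K - 1).choose (s - 1) : ℝ) := by
    exact_mod_cast Nat.choose_pos (by omega)
  have hK' : (0 : ℝ) < K := by positivity
  have h0 : (0 : ℝ) ≤ ((K : ℝ) * ((K - 1).choose (s - 1) : ℝ)) * schemeLoad d s := by
    rw [h]; positivity
  exact nonneg_of_mul_nonneg_right h0 (by positivity)

/-- Memory sharing between the schemes with integer parameters, in rational proportions. -/
theorem exists_placement_memorySharing (K N : ℕ) (M : ℝ) (hK : 0 < K) (hN : 0 < N) (v : ℕ → ℕ)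
    (n : ℕ) (hn : 0 < n) (hv : ∑ s ∈ Icc 1 K, v s = n)
    (hvM : ((∑ s ∈ Icc 1 K, v s * s : ℕ) : ℝ) ≤ n * (K * M / N)) :
    ∃ F, 0 < F ∧ ∃ Z : Placement K N F, Z.FitsMemory M ∧
      ∀ d, minLoadOneShot Z d ≤
        ENNReal.ofReal (∑ s ∈ Icc 1 K, (v s : ℝ) / n * schemeLoad d s) := by
  classical
  set c : ℕ → ℕ := fun s => (K - 1).choose (s - 1) with hc
  have cpos : ∀ s ∈ Icc 1 K, 0 < c s := by
    intro s hs; rw [mem_Icc] at hs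
    exact Nat.choose_pos (by omega)
  set Q := ∏ s ∈ Icc 1 K, c s with hQ
  have Qpos : 0 < Q := prod_pos cpos
  -- One copy with parameter `s` uses `K * c s` bits of a file, so `m s` copies use `K * Q * v s`:
  -- the shares of the file are exactly `v s / n`.
  set m : ℕ → ℕ := fun s => v s * (Q / c s) with hm
  have hmc : ∀ s ∈ Icc 1 K, m s * c s = v s * Q := by
    intro s hs
    rw [hm]; simp only
    rw [mul_assoc, Nat.div_mul_cancel (dvd_prod_of_mem c hs)]
  let A : Type := Σ s : {s // s ∈ Icc 1 K}, Fin (m s)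
  let sA : A → ℕ := fun a => a.1.1
  have hsum : ∀ g : ℕ → ℕ, ∑ a : A, g (sA a) = ∑ s ∈ Icc 1 K, m s * g s := by
    intro g
    rw [Fintype.sum_sigma, ← sum_coe_sort (Icc 1 K) (fun s => m s * g s)]
    refine sum_congr rfl fun s _ => ?_
    simp [sA]
  have h1 : ∀ a, 1 ≤ sA a := fun a => (mem_Icc.mp a.1.2).1
  have h2 : ∀ a, sA a ≤ K := fun a => (mem_Icc.mp a.1.2).2
  have hF : K * Q * n = ∑ a, K * (K - 1).choose (sA a - 1) := by
    rw [hsum (fun s => K * (K - 1).choose (s - 1)), ← hv, mul_sum]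
    refine sum_congr rfl fun s hs => ?_
    rw [mul_left_comm, hmc s hs]; ring
  obtain ⟨Z, hZ, hZd⟩ := exists_placement K N (K * Q * n) sA h1 h2 hF
  refine ⟨K * Q * n, by positivity, Z, fun k => ?_, fun d => (hZd d).trans ?_⟩
  · rw [hZ k, hsum (fun s => s * (K - 1).choose (s - 1))]
    have : ∑ s ∈ Icc 1 K, m s * (s * (K - 1).choose (s - 1)) = Q * ∑ s ∈ Icc 1 K, v s * s := by
      rw [mul_sum]
      refine sum_congr rfl fun s hs => ?_
      rw [mul_left_comm, hmc s hs]; ring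
    rw [this]
    push_cast at hvM ⊢
    have hNr : (0 : ℝ) < N := by positivity
    calc (N : ℝ) * (Q * ∑ s ∈ Icc 1 K, (v s : ℝ) * s) ≤ N * (Q * (n * (K * M / N))) := by
          gcongr
      _ = M * (K * Q * n) := by field_simp
  · have hnum : ((∑ j, ∑ a, ((K - 1).choose (sA a) -
        (K - 1 - numDistinctExcept d j).choose (sA a)) : ℕ) : ℝ)
        = (K * Q * n : ℕ) * ∑ s ∈ Icc 1 K, (v s : ℝ) / n * schemeLoad d s := by
      rw [sum_comm, hsum (fun s => ∑ j, ((K - 1).choose s -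
        (K - 1 - numDistinctExcept d j).choose s)), Nat.cast_sum, mul_sum]
      refine sum_congr rfl fun s hs => ?_
      rw [Nat.cast_mul, ← mul_schemeLoad hK d s hs]
      have : (m s : ℝ) * ((K - 1).choose (s - 1) : ℝ) = v s * Q := by exact_mod_cast hmc s hs
      push_cast
      have hnr : (n : ℝ) ≠ 0 := by positivity
      field_simp
      linear_combination (schemeLoad d s) * this
    have hFpos : (0 : ℝ) < ((K * Q * n : ℕ) : ℝ) := by
      have : 0 < K * Q * n := by positivity
      exact_mod_cast this
    rw [← ENNReal.ofReal_natCast, ← ENNReal.ofReal_natCast (K * Q * n),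
      ← ENNReal.ofReal_div_of_pos hFpos, hnum, mul_div_cancel_left₀ _ hFpos.ne']

/-- Rational approximation of a convex combination, rounded towards the smallest parameter. -/
theorem exists_nat_weights (K n : ℕ) (hK : 0 < K) (hn : 0 < n) (w : ℕ → ℝ) (x : ℝ)
    (hw : ∀ s ∈ Icc 1 K, 0 ≤ w s) (hw1 : ∑ s ∈ Icc 1 K, w s = 1)
    (hwx : ∑ s ∈ Icc 1 K, w s * (s : ℝ) = x) :
    ∃ v : ℕ → ℕ, ∑ s ∈ Icc 1 K, v s = n ∧ ((∑ s ∈ Icc 1 K, v s * s : ℕ) : ℝ) ≤ n * x ∧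
      ∀ q : ℕ → ℝ, (∀ s ∈ Icc 1 K, 0 ≤ q s) →
        ∑ s ∈ Icc 1 K, (v s : ℝ) / n * q s ≤ ∑ s ∈ Icc 1 K, w s * q s + K * q 1 / n := by
  have hnr : (0 : ℝ) < n := by positivity
  have h1 : 1 ∈ Icc 1 K := mem_Icc.mpr ⟨le_rfl, hK⟩
  set f : ℕ → ℕ := fun s => ⌊w s * n⌋₊ with hf
  have hfle : ∀ s ∈ Icc 1 K, (f s : ℝ) ≤ w s * n := fun s hs =>
    Nat.floor_le (mul_nonneg (hw s hs) hnr.le)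
  have hfge : ∀ s, w s * n - 1 ≤ (f s : ℝ) := fun s => (Nat.sub_one_lt_floor _).le
  have hsum_le : ∑ s ∈ Icc 1 K, f s ≤ n := by
    have : ((∑ s ∈ Icc 1 K, f s : ℕ) : ℝ) ≤ n := by
      push_cast
      calc ∑ s ∈ Icc 1 K, (f s : ℝ) ≤ ∑ s ∈ Icc 1 K, w s * n := sum_le_sum hfle
        _ = n := by rw [← sum_mul, hw1, one_mul]
    exact_mod_cast this
  -- The deficit left by the floors, at most `K`, goes to parameter `1`. Since mass only moves down
  -- from some `s ≥ 1`, the memory does not grow, and the extra cost is at most `K * q 1 / n`.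
  set δ := n - ∑ s ∈ Icc 1 K, f s with hδ
  have hδr : (δ : ℝ) = n - ∑ s ∈ Icc 1 K, (f s : ℝ) := by
    rw [hδ, Nat.cast_sub hsum_le, Nat.cast_sum]
  have hδr' : (δ : ℝ) = ∑ s ∈ Icc 1 K, (w s * n - f s) := by
    rw [hδr, sum_sub_distrib, ← sum_mul, hw1, one_mul]
  have hδK : (δ : ℝ) ≤ K := by
    rw [hδr']
    calc ∑ s ∈ Icc 1 K, (w s * n - f s) ≤ ∑ s ∈ Icc 1 K, (1 : ℝ) :=
          sum_le_sum fun s _ => by linarith [hfge s]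
      _ = K := by simp
  have hgen : ∀ g : ℕ → ℝ, ∑ s ∈ Icc 1 K, ((f s + if s = 1 then δ else 0 : ℕ) : ℝ) * g s
      = ∑ s ∈ Icc 1 K, (f s : ℝ) * g s + δ * g 1 := by
    intro g
    have : ∀ s ∈ Icc 1 K, ((f s + if s = 1 then δ else 0 : ℕ) : ℝ) * g s
        = (f s : ℝ) * g s + if s = 1 then δ * g s else 0 := by
      intro s _; split_ifs <;> push_cast <;> ring
    rw [sum_congr rfl this, sum_add_distrib, sum_ite_eq' , if_pos h1]
  refine ⟨fun s => f s + if s = 1 then δ else 0, ?_, ?_, ?_⟩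
  · rw [sum_add_distrib, sum_ite_eq', if_pos h1]
    omega
  · have := hgen (fun s => (s : ℝ))
    push_cast at this ⊢
    rw [this, mul_one, hδr', ← sum_add_distrib, ← hwx, mul_sum]
    refine sum_le_sum fun s hs => ?_
    have hs1 : (1 : ℝ) ≤ s := by exact_mod_cast (mem_Icc.mp hs).1
    nlinarith [hfle s hs]
  · intro q hq
    have h := hgen (fun s => q s / n)
    have e : ∀ s, ((f s + if s = 1 then δ else 0 : ℕ) : ℝ) / n * q s
        = ((f s + if s = 1 then δ else 0 : ℕ) : ℝ) * (q s / n) := fun s => by ring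
    rw [sum_congr rfl fun s _ => e s, h]
    refine add_le_add (sum_le_sum fun s hs => ?_) ?_
    · rw [mul_div_assoc', div_le_iff₀ hnr]
      nlinarith [hfle s hs, hq s hs]
    · rw [mul_div_assoc]
      exact mul_le_mul_of_nonneg_right hδK (div_nonneg (hq 1 h1) hnr.le)

/-- Every convex combination of the loads at the integers is achieved up to any error. -/
theorem exists_placement_approx (K N : ℕ) (M : ℝ) (hK : 0 < K) (hN : 0 < N) (w : ℕ → ℝ)
    (hw : ∀ s ∈ Icc 1 K, 0 ≤ w s) (hw1 : ∑ s ∈ Icc 1 K, w s = 1)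
    (hwx : ∑ s ∈ Icc 1 K, w s * (s : ℝ) = K * M / N) (q : ℕ → ℝ) (hq : ∀ s ∈ Icc 1 K, 0 ≤ q s)
    (ε : ℝ) (hε : 0 < ε) :
    ∃ (v : ℕ → ℝ), (∀ s ∈ Icc 1 K, 0 ≤ v s) ∧
      ∑ s ∈ Icc 1 K, v s * q s ≤ ∑ s ∈ Icc 1 K, w s * q s + ε ∧
      ∃ F, 0 < F ∧ ∃ Z : Placement K N F, Z.FitsMemory M ∧
      ∀ d, minLoadOneShot Z d ≤ ENNReal.ofReal (∑ s ∈ Icc 1 K, v s * schemeLoad d s) := by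
  obtain ⟨n, hn⟩ := exists_nat_gt (K * q 1 / ε)
  have hn0 : 0 < n := by
    have h1 : 0 ≤ q 1 := hq 1 (mem_Icc.mpr ⟨le_rfl, hK⟩)
    have : (0 : ℝ) < n := lt_of_le_of_lt (by positivity) hn
    exact_mod_cast this
  obtain ⟨v, hv1, hv2, hv3⟩ := exists_nat_weights K n hK hn0 w _ hw hw1 hwx
  obtain ⟨F, hF, Z, hZ, hZd⟩ := exists_placement_memorySharing K N M hK hN v n hn0 hv1 hv2
  refine ⟨fun s => (v s : ℝ) / n, fun s _ => by positivity, ?_, F, hF, Z, hZ, hZd⟩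
  refine (hv3 q hq).trans (add_le_add le_rfl ?_)
  have hnr : (0 : ℝ) < n := by positivity
  rw [div_lt_iff₀ hε] at hn
  rw [div_le_iff₀ hnr]
  linarith

/-! ### Achievability of the average and worst-case loads -/

theorem schemeAveAt_nonneg {K N : ℕ} (hK : 0 < K) (s : ℕ) (hs : s ∈ Icc 1 K) :
    0 ≤ schemeAveAt K N s :=
  div_nonneg (sum_nonneg fun d _ => schemeLoad_nonneg hK d s hs) (by positivity)

theorem numDistinctExcept_le {K N : ℕ} (d : Demand K N) (k : Fin K) :
    numDistinctExcept d k ≤ N :=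
  (card_le_univ ((univ.erase k).image d)).trans_eq (Fintype.card_fin N)

/-- At least `2 N - K` of the users see fewer than `N` distinct requests of the others. -/
theorem card_filter_numDistinctExcept_lt {K N : ℕ} (hNK : N ≤ K) (d : Demand K N) :
    2 * N ≤ K + (univ.filter fun k => numDistinctExcept d k < N).card := by
  classical
  by_cases hd : ∀ k, numDistinctExcept d k < N
  · rw [filter_true_of_mem fun k _ => hd k, card_fin]; omega
  have hsurj : ∀ n, ∃ k, d k = n := by
    push Not at hd
    obtain ⟨k, hk⟩ := hd
    intro n
    have : n ∈ (univ.erase k).image d := by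
      rw [eq_univ_of_card ((univ.erase k).image d)
        (by rw [Fintype.card_fin]; exact le_antisymm (numDistinctExcept_le d k) hk)]
      exact mem_univ n
    obtain ⟨k', -, h⟩ := mem_image.mp this
    exact ⟨k', h⟩
  have hfib : ∑ n : Fin N, (univ.filter fun k => d k = n).card = K := by
    have := card_eq_sum_card_fiberwise (f := d) (s := univ) (t := univ) (fun _ _ => by simp)
    simpa using this.symm
  have hfib' : ∑ n : Fin N, ((univ.filter fun k => numDistinctExcept d k < N).filter
      fun k => d k = n).card = (univ.filter fun k => numDistinctExcept d k < N).card :=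
    (card_eq_sum_card_fiberwise (f := d) (s := univ.filter fun k => numDistinctExcept d k < N)
      (t := univ) (fun _ _ => by simp)).symm
  -- Every file is requested here. Each contributes at least two: it has either two requesters, or a
  -- sole requester, whose removal leaves fewer than `N` distinct requests.
  calc 2 * N = ∑ _n : Fin N, 2 := by simp [mul_comm]
    _ ≤ ∑ n : Fin N, ((univ.filter fun k => d k = n).card +
        ((univ.filter fun k => numDistinctExcept d k < N).filter fun k => d k = n).card) := by
        refine sum_le_sum fun n _ => ?_
        obtain ⟨k, hk⟩ := hsurj n
        have hkm : k ∈ univ.filter fun k => d k = n := by simp [hk]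
        have hpos := card_pos.mpr ⟨k, hkm⟩
        by_cases h1 : (univ.filter fun k => d k = n).card = 1
        · have huniq : ∀ k', d k' = n → k' = k := fun k' h' =>
            card_le_one.mp h1.le k' (by simp [h']) k hkm
          have hlt : numDistinctExcept d k < N := by
            have : (univ.erase k).image d ⊂ univ := by
              refine (ssubset_univ_iff).mpr fun h => ?_
              have hn : n ∈ (univ.erase k).image d := by rw [h]; exact mem_univ n
              obtain ⟨k', hk', h'⟩ := mem_image.mp hn
              exact ne_of_mem_erase hk' (huniq k' h')
            have := card_lt_card this
            rwa [card_fin] at this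
          have : 0 < ((univ.filter fun k => numDistinctExcept d k < N).filter
              fun k => d k = n).card := card_pos.mpr ⟨k, by simp [hk, hlt]⟩
          omega
        · omega
    _ = _ := by rw [sum_add_distrib, hfib, hfib']

/-- The subtracted mean has to be bounded below. For `N < K < 2 * N`, at least `2 * N - K` users see
at most `N - 1` distinct requests and contribute at least `(K - N).choose s`; the others contribute
at least `(K - 1 - N).choose s`. More users of the first kind only increase the mean. -/
theorem schemeLoad_le_schemeWorstAt {K N : ℕ} (hK : 0 < K) (d : Demand K N) (s : ℕ) :
    schemeLoad d s ≤ schemeWorstAt K N s := by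
  classical
  have hKr : (0 : ℝ) < K := by positivity
  unfold schemeLoad schemeWorstAt
  split_ifs with h1 h2
  · refine div_le_div_of_nonneg_right (sub_le_self _ ?_) (by positivity)
    positivity
  · refine div_le_div_of_nonneg_right (sub_le_sub_left ?_ _) (by positivity)
    rw [one_div, inv_mul_eq_div, le_div_iff₀ hKr]
    calc ((K - 1 - N).choose s : ℝ) * K = ∑ _k : Fin K, ((K - 1 - N).choose s : ℝ) := by
          simp [mul_comm]
      _ ≤ _ := by
          refine sum_le_sum fun k _ => ?_
          have := numDistinctExcept_le d k
          exact_mod_cast Nat.choose_le_choose s (by omega)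
  · push Not at h1 h2
    refine div_le_div_of_nonneg_right ?_ (by positivity)
    rw [sub_sub]
    refine sub_le_sub_left ?_ _
    set P := univ.filter fun k => numDistinctExcept d k < N with hP
    have hcard := card_filter_numDistinctExcept_lt h1.le d
    have hcardr : 2 * (N : ℝ) ≤ K + (P.card : ℝ) := by exact_mod_cast hcard
    have hle : ((K - 1 - N).choose s : ℝ) ≤ ((K - N).choose s : ℝ) := by
      exact_mod_cast Nat.choose_le_choose s (by omega)
    have hsum : (P.card : ℝ) * ((K - N).choose s : ℝ)
        + ((K : ℝ) - P.card) * ((K - 1 - N).choose s : ℝ)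
        ≤ ∑ k, ((K - 1 - numDistinctExcept d k).choose s : ℝ) := by
      rw [← sum_filter_add_sum_filter_not univ (fun k => numDistinctExcept d k < N)]
      have hc : (univ.filter fun k => ¬ numDistinctExcept d k < N).card + P.card = K := by
        rw [add_comm, hP, card_filter_add_card_filter_not, card_fin]
      have hc' : (K : ℝ) - P.card = ((univ.filter fun k => ¬ numDistinctExcept d k < N).card : ℝ) := by
        have := congrArg (Nat.cast (R := ℝ)) hc
        push_cast at this
        linarith
      rw [hc', ← nsmul_eq_mul, ← nsmul_eq_mul]
      refine add_le_add (card_nsmul_le_sum _ _ _ fun k hk => ?_)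
        (card_nsmul_le_sum _ _ _ fun k _ => ?_)
      · have := (mem_filter.mp hk).2
        exact_mod_cast Nat.choose_le_choose s (by omega)
      · have := numDistinctExcept_le d k
        exact_mod_cast Nat.choose_le_choose s (by omega)
    rw [one_div, inv_mul_eq_div, div_mul_eq_mul_div, div_mul_eq_mul_div, ← add_div]
    refine div_le_div_of_nonneg_right ?_ hKr.le
    nlinarith

theorem schemeWorstAt_nonneg {K N : ℕ} (hK : 0 < K) (hN : 0 < N) (s : ℕ) (hs : s ∈ Icc 1 K) :
    0 ≤ schemeWorstAt K N s :=
  (schemeLoad_nonneg hK (fun _ => ⟨0, hN⟩ : Demand K N) s hs).trans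
    (schemeLoad_le_schemeWorstAt hK _ s)

theorem optAveOneShot_le_of_weights (K N : ℕ) (M : ℝ) (hK : 0 < K) (hN : 0 < N) (w : ℕ → ℝ)
    (hw : ∀ s ∈ Icc 1 K, 0 ≤ w s) (hw1 : ∑ s ∈ Icc 1 K, w s = 1)
    (hwx : ∑ s ∈ Icc 1 K, w s * (s : ℝ) = K * M / N) :
    optAveOneShot K N M ≤ ENNReal.ofReal (∑ s ∈ Icc 1 K, w s * schemeAveAt K N s) := by
  refine ENNReal.le_of_forall_pos_le_add fun ε hε _ => ?_
  obtain ⟨v, hv, hvq, F, hF, Z, hZ, hZd⟩ := exists_placement_approx K N M hK hN w hw hw1 hwx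
    (schemeAveAt K N) (schemeAveAt_nonneg hK) ε (by exact_mod_cast hε)
  have hNK : (0 : ℝ) < (N : ℝ) ^ K := by positivity
  unfold optAveOneShot
  refine iInf₂_le_of_le F hF (iInf₂_le_of_le Z hZ ?_)
  calc (∑ d : Demand K N, minLoadOneShot Z d) / ((N : ℝ≥0∞) ^ K)
      ≤ (∑ d : Demand K N, ENNReal.ofReal (∑ s ∈ Icc 1 K, v s * schemeLoad d s))
          / ((N : ℝ≥0∞) ^ K) := ENNReal.div_le_div_right (sum_le_sum fun d _ => hZd d) _
    _ = ENNReal.ofReal (∑ s ∈ Icc 1 K, v s * schemeAveAt K N s) := by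
        rw [← ENNReal.ofReal_sum_of_nonneg fun d _ => sum_nonneg fun s hs =>
          mul_nonneg (hv s hs) (schemeLoad_nonneg hK d s hs), ← ENNReal.ofReal_natCast,
          ← ENNReal.ofReal_pow (by positivity), ← ENNReal.ofReal_div_of_pos hNK, sum_comm, sum_div]
        congr 1
        refine sum_congr rfl fun s _ => ?_
        rw [schemeAveAt, ← mul_sum, mul_div_assoc]
    _ ≤ ENNReal.ofReal (∑ s ∈ Icc 1 K, w s * schemeAveAt K N s + ε) := ENNReal.ofReal_le_ofReal hvq
    _ ≤ _ := ENNReal.ofReal_add_le.trans_eq (by rw [ENNReal.ofReal_coe_nnreal])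

theorem optWorstOneShot_le_of_weights (K N : ℕ) (M : ℝ) (hK : 0 < K) (hN : 0 < N) (w : ℕ → ℝ)
    (hw : ∀ s ∈ Icc 1 K, 0 ≤ w s) (hw1 : ∑ s ∈ Icc 1 K, w s = 1)
    (hwx : ∑ s ∈ Icc 1 K, w s * (s : ℝ) = K * M / N) :
    optWorstOneShot K N M ≤ ENNReal.ofReal (∑ s ∈ Icc 1 K, w s * schemeWorstAt K N s) := by
  refine ENNReal.le_of_forall_pos_le_add fun ε hε _ => ?_
  obtain ⟨v, hv, hvq, F, hF, Z, hZ, hZd⟩ := exists_placement_approx K N M hK hN w hw hw1 hwx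
    (schemeWorstAt K N) (schemeWorstAt_nonneg hK hN) ε (by exact_mod_cast hε)
  unfold optWorstOneShot
  refine iInf₂_le_of_le F hF (iInf₂_le_of_le Z hZ (iSup_le fun d => ?_))
  calc minLoadOneShot Z d
      ≤ ENNReal.ofReal (∑ s ∈ Icc 1 K, v s * schemeLoad d s) := hZd d
    _ ≤ ENNReal.ofReal (∑ s ∈ Icc 1 K, v s * schemeWorstAt K N s) :=
        ENNReal.ofReal_le_ofReal (sum_le_sum fun s hs =>
          mul_le_mul_of_nonneg_left (schemeLoad_le_schemeWorstAt hK d s) (hv s hs))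
    _ ≤ ENNReal.ofReal (∑ s ∈ Icc 1 K, w s * schemeWorstAt K N s + ε) :=
        ENNReal.ofReal_le_ofReal hvq
    _ ≤ _ := ENNReal.ofReal_add_le.trans_eq (by rw [ENNReal.ofReal_coe_nnreal])

/-- A bound by all convex combinations with abscissa `x` is a bound by the extension at `x`. -/
theorem le_ofReal_extendByEnvelope (K : ℕ) (r : ℕ → ℝ) (x : ℝ) (hr : ∀ s ∈ Icc 1 K, 0 ≤ r s)
    (hx1 : 1 ≤ x) (hxK : x < K) (a : ℝ≥0∞)
    (h : ∀ w : ℕ → ℝ, (∀ s ∈ Icc 1 K, 0 ≤ w s) → ∑ s ∈ Icc 1 K, w s = 1 →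
      ∑ s ∈ Icc 1 K, w s * (s : ℝ) = x → a ≤ ENNReal.ofReal (∑ s ∈ Icc 1 K, w s * r s)) :
    a ≤ ENNReal.ofReal (extendByEnvelope K r x) := by
  unfold extendByEnvelope
  have hK1 : (1 : ℝ) < K := hx1.trans_lt hxK
  have h1m : 1 ∈ Icc 1 K := mem_Icc.mpr ⟨le_rfl, by exact_mod_cast hK1.le⟩
  have hKm : K ∈ Icc 1 K := mem_Icc.mpr ⟨by exact_mod_cast hK1.le, le_rfl⟩
  split_ifs with hx
  · have ht : ⌊x⌋₊ ∈ Icc 1 K := by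
      rw [mem_Icc]
      constructor
      · exact (Nat.one_le_floor_iff x).mpr hx1
      · exact Nat.floor_le_of_le hxK.le
    have := h (fun s => if s = ⌊x⌋₊ then 1 else 0) (fun s _ => by positivity)
      (by rw [sum_ite_eq', if_pos ht])
      (by simp only [ite_mul, one_mul, zero_mul]; rw [sum_ite_eq', if_pos ht]; exact hx.symm)
    simp only [ite_mul, one_mul, zero_mul] at this
    rwa [sum_ite_eq', if_pos ht] at this
  · have hd : (0 : ℝ) < K - 1 := by linarith
    -- The two-point combination of `1` and `K` shows that `a` is finite and that the set defining
    -- the envelope is nonempty.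
    set w0 : ℕ → ℝ := fun s => (if s = 1 then (K - x) / (K - 1) else 0)
      + (if s = K then (x - 1) / (K - 1) else 0) with hw0
    have hw0s : ∀ g : ℕ → ℝ, ∑ s ∈ Icc 1 K, w0 s * g s
        = (K - x) / (K - 1) * g 1 + (x - 1) / (K - 1) * g K := by
      intro g
      simp only [hw0, add_mul, ite_mul, zero_mul]
      rw [sum_add_distrib, sum_ite_eq', sum_ite_eq', if_pos h1m, if_pos hKm]
    have hw0n : ∀ s ∈ Icc 1 K, 0 ≤ w0 s := by
      intro s _
      have : 0 ≤ (K - x) / (K - 1) := div_nonneg (by linarith) hd.le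
      have : 0 ≤ (x - 1) / (K - 1) := div_nonneg (by linarith) hd.le
      simp only [hw0]; positivity
    have hw01 : ∑ s ∈ Icc 1 K, w0 s = 1 := by
      have := hw0s (fun _ => 1)
      simp only [mul_one] at this
      rw [this]; field_simp; ring
    have hw0x : ∑ s ∈ Icc 1 K, w0 s * (s : ℝ) = x := by
      rw [hw0s (fun s => (s : ℝ))]; push_cast; field_simp; ring
    have ha : a ≠ ⊤ := ne_top_of_le_ne_top ENNReal.ofReal_ne_top (h w0 hw0n hw01 hw0x)
    unfold lowerConvexEnvelope
    refine (ENNReal.le_ofReal_iff_toReal_le ha ?_).mpr ?_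
    · refine Real.sInf_nonneg ?_
      rintro y ⟨w, hw, -, -, rfl⟩
      exact sum_nonneg fun s hs => mul_nonneg (hw s hs) (hr s hs)
    · refine le_csInf ⟨_, w0, hw0n, hw01, hw0x, rfl⟩ ?_
      rintro y ⟨w, hw, hw1, hwx, rfl⟩
      exact ENNReal.toReal_le_of_le_ofReal
        (sum_nonneg fun s hs => mul_nonneg (hw s hs) (hr s hs)) (h w hw hw1 hwx)

/-! ### Acyclic index coding bound -/

/-- The acyclic index coding bound: users with distinct requests, in any order; the bits of the
request of each that neither it nor any earlier one has cached are determined by the codewords. -/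
theorem Delivery.Decodes.acyclic_bound {K N F m : ℕ} {Z : Placement K N F} {X : Delivery Z}
    {d : Demand K N} (hX : X.Decodes d) (l : Fin m → Fin K)
    (hl : Function.Injective (d ∘ l)) :
    ∑ i, (univ.filter fun b : Fin F => ∀ j ≤ i, (d (l i), b) ∉ Z (l j)).card
      ≤ ∑ k, X.len k := by
  classical
  let S : Fin m → Finset (Fin N × Fin F) := fun i =>
    (univ.filter fun b : Fin F => ∀ j ≤ i, (d (l i), b) ∉ Z (l j)).image (fun b => (d (l i), b))
  let A := univ.biUnion S
  have memA : ∀ p, p ∈ A ↔ ∃ i, d (l i) = p.1 ∧ ∀ j ≤ i, p ∉ Z (l j) := by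
    rintro ⟨n, b⟩
    simp only [A, S, mem_biUnion, mem_univ, true_and, mem_image, mem_filter, Prod.mk.injEq]
    constructor
    · rintro ⟨i, b', h, rfl, rfl⟩; exact ⟨i, rfl, h⟩
    · rintro ⟨i, rfl, h⟩; exact ⟨i, b, h, rfl, rfl⟩
  have hcard : A.card
      = ∑ i, (univ.filter fun b : Fin F => ∀ j ≤ i, (d (l i), b) ∉ Z (l j)).card := by
    rw [card_biUnion]
    · exact sum_congr rfl fun i _ => card_image_of_injective _ fun b b' h => (Prod.mk.inj h).2
    · intro i _ i' _ hne
      refine disjoint_left.mpr fun p hp hp' => hne (hl ?_)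
      obtain ⟨b, -, rfl⟩ := mem_image.mp hp
      obtain ⟨b', -, h⟩ := mem_image.mp hp'
      exact (Prod.mk.inj h).1.symm
  let lib : (A → Bool) → Library N F := fun y n b =>
    if h : (n, b) ∈ A then y ⟨_, h⟩ else false
  let cw : (A → Bool) → ∀ k, Fin (X.len k) → Bool := fun y k => X.codeword (lib y) k
  -- Only the bits in `A` vary. When user `l i` decodes, its cached bits in `A` belong to files of
  -- earlier users, already recovered. The codewords therefore determine all of `A`, so they have at
  -- least `A.card` bits.
  have hinj : Function.Injective cw := by
    intro y y' hy
    have hfile : ∀ i, lib y (d (l i)) = lib y' (d (l i)) := by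
      intro i
      induction i using Fin.strong_induction_on with
      | _ i ih =>
        obtain ⟨dec, hdec⟩ := hX (l i)
        rw [← hdec (lib y), ← hdec (lib y')]
        have h1 : cacheContent (Z (l i)) (lib y) = cacheContent (Z (l i)) (lib y') := by
          funext p
          obtain ⟨⟨n, b⟩, hp⟩ := p
          change lib y n b = lib y' n b
          by_cases hA : (n, b) ∈ A
          · obtain ⟨i', rfl, hi'⟩ := (memA _).mp hA
            have : i' < i := by
              by_contra hlt
              exact hi' i (not_lt.mp hlt) hp
            rw [ih i' this]
          · simp only [lib, dif_neg hA]
        have h2 : (fun k : {k : Fin K // k ≠ l i} => X.codeword (lib y) k)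
            = fun k : {k : Fin K // k ≠ l i} => X.codeword (lib y') k := by
          funext k
          exact congrFun hy k.1
        rw [h1, h2]
    funext p
    obtain ⟨⟨n, b⟩, hp⟩ := p
    obtain ⟨i, rfl, -⟩ := (memA _).mp hp
    have := congrFun (hfile i) b
    simpa only [lib, dif_pos hp] using this
  have := Fintype.card_le_of_injective cw hinj
  simp only [Fintype.card_pi, Fintype.card_bool, prod_const, card_univ, Fintype.card_coe,
    Fintype.card_fin, prod_pow_eq_pow_sum] at this
  rw [← hcard]
  exact (Nat.pow_le_pow_iff_right (by norm_num)).mp this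

/-- Two libraries that differ only at `p` give the same caches and codewords, so no user can decode
that file. -/
theorem minLoad_eq_top {K N F : ℕ} (hK : 0 < K) (Z : Placement K N F) (p : Fin N × Fin F)
    (hp : ∀ k, p ∉ Z k) : minLoad Z (fun _ => p.1) = ⊤ := by
  classical
  unfold minLoad
  simp only [iInf_eq_top]
  intro X hX
  exfalso
  obtain ⟨dec, hdec⟩ := hX ⟨0, hK⟩
  let W : Library N F := fun _ _ => false
  let W' : Library N F := fun n b => decide ((n, b) = p)
  have hc : ∀ k, cacheContent (Z k) W = cacheContent (Z k) W' := by
    intro k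
    funext q
    have : q.1 ≠ p := fun h => hp k (h ▸ q.2)
    simp only [cacheContent, W, W', Prod.mk.eta]
    simp [this]
  have h1 := hdec W
  have h2 := hdec W'
  simp only [Delivery.codeword, hc] at h1
  simp only [Delivery.codeword] at h2
  have := congrFun (h1.symm.trans h2) p.2
  simp [W, W'] at this

/-! ### The symmetrised bound `cutLoad`, its convexity, and the factor two -/

/-- The probability that a random set of `I.card` users misses `S`. -/
theorem sum_perm_disjoint {K : ℕ} (I S : Finset (Fin K)) :
    (∑ u : Equiv.Perm (Fin K), if ∀ k ∈ I, u k ∉ S then 1 else 0) * K.choose I.card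
      = K.factorial * (K - S.card).choose I.card := by
  classical
  -- The count depends only on the size of `I`, so it may be summed over all sets of that size. For
  -- a fixed permutation, the sets whose image misses `S` are the subsets of a set of `K - S.card`
  -- users.
  have hsymm : ∀ I' ∈ (univ : Finset (Fin K)).powersetCard I.card,
      (∑ u : Equiv.Perm (Fin K), if ∀ k ∈ I', u k ∉ S then 1 else 0)
        = ∑ u : Equiv.Perm (Fin K), if ∀ k ∈ I, u k ∉ S then 1 else 0 := by
    intro I' hI'
    have hc : I'.card = I.card := (mem_powersetCard.mp hI').2
    let e : {k // k ∈ I} ≃ {k // k ∈ I'} := Fintype.equivOfCardEq (by simp [hc])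
    let π : Equiv.Perm (Fin K) := e.extendSubtype
    rw [← Equiv.sum_comp (Equiv.mulRight π) (fun u => if ∀ k ∈ I, u k ∉ S then 1 else 0)]
    refine sum_congr rfl fun u _ => if_congr ?_ rfl rfl
    simp only [Equiv.coe_mulRight, Equiv.Perm.mul_apply]
    constructor
    · intro h k hk
      exact h _ (e.extendSubtype_mem k hk)
    · intro h k hk
      have h1 := h _ (e.symm ⟨k, hk⟩).2
      have h2 : π (e.symm ⟨k, hk⟩).1 = k := by
        rw [e.extendSubtype_apply_of_mem _ (e.symm ⟨k, hk⟩).2]; simp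
      rwa [h2] at h1
  have h1 : ∑ I' ∈ (univ : Finset (Fin K)).powersetCard I.card,
      (∑ u : Equiv.Perm (Fin K), if ∀ k ∈ I', u k ∉ S then 1 else 0)
      = K.choose I.card * ∑ u : Equiv.Perm (Fin K), if ∀ k ∈ I, u k ∉ S then 1 else 0 := by
    rw [sum_congr rfl hsymm, sum_const, card_powersetCard, card_fin, smul_eq_mul]
  have h2 : ∀ u : Equiv.Perm (Fin K), (∑ I' ∈ (univ : Finset (Fin K)).powersetCard I.card,
      if ∀ k ∈ I', u k ∉ S then 1 else 0) = (K - S.card).choose I.card := by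
    intro u
    rw [← card_filter]
    have : ((univ : Finset (Fin K)).powersetCard I.card).filter (fun I' => ∀ k ∈ I', u k ∉ S)
        = ((S.map u.symm.toEmbedding)ᶜ).powersetCard I.card := by
      ext I'
      simp only [mem_filter, mem_powersetCard, subset_iff, mem_compl, mem_map_equiv,
        Equiv.symm_symm, mem_univ, implies_true, true_and]
      tauto
    rw [this, card_powersetCard, card_compl, card_map, Fintype.card_fin]
  rw [sum_comm, sum_congr rfl fun u _ => h2 u, sum_const, card_univ, Fintype.card_perm,
    Fintype.card_fin, smul_eq_mul] at h1
  rw [h1, mul_comm]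

/-- The load needed in the symmetric placement with parameter `s` when `m` distinct files are
requested from a server. -/
noncomputable def cutLoad (K m s : ℕ) : ℝ :=
  ∑ i ∈ range m, ((K - s).choose (i + 1) : ℝ) / (K.choose (i + 1) : ℝ)

/-- Each summand becomes `(K - (i + 1)).choose s` by the two ways of choosing disjoint sets of sizes
`s` and `i + 1`; the sum then telescopes by Pascal's rule. -/
theorem choose_mul_cutLoad (K m s : ℕ) (hm : m ≤ K) :
    (K.choose s : ℝ) * cutLoad K m s = K.choose (s + 1) - (K - m).choose (s + 1) := by
  have hterm : ∀ i ∈ range m, (K.choose s : ℝ) *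
      (((K - s).choose (i + 1) : ℝ) / (K.choose (i + 1) : ℝ)) = ((K - (i + 1)).choose s : ℝ) := by
    intro i hi
    have hi' := mem_range.mp hi
    have hpos : (K.choose (i + 1) : ℝ) ≠ 0 := by
      have : 0 < K.choose (i + 1) := Nat.choose_pos (by omega)
      positivity
    rw [mul_div_assoc', div_eq_iff hpos]
    have h1 : K.choose s * (K - s).choose (i + 1) = K.choose (i + 1) * (K - (i + 1)).choose s := by
      have e1 := Nat.choose_mul (n := K) (k := s + (i + 1)) (s := s) (by omega)
      have e2 := Nat.choose_mul (n := K) (k := s + (i + 1)) (s := i + 1) (by omega)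
      rw [Nat.add_sub_cancel_left] at e1
      rw [Nat.add_sub_cancel] at e2
      rw [← e1, ← e2, Nat.choose_symm_add]
    rw [mul_comm (((K - (i + 1)).choose s : ℕ) : ℝ)]
    exact_mod_cast h1
  rw [cutLoad, mul_sum, sum_congr rfl hterm]
  clear hterm
  induction m with
  | zero => simp
  | succ m ih =>
    rw [sum_range_succ, ih (by omega)]
    have : (K - m).choose (s + 1) = (K - (m + 1)).choose s + (K - (m + 1)).choose (s + 1) := by
      rw [show K - m = (K - (m + 1)) + 1 by omega, Nat.choose_succ_succ]
    rw [this]; push_cast; ring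

/-- By Pascal's rule each of the `k` increments is a binomial with lower index `i`, at least
`n.choose i`. -/
theorem choose_support_add (n i k : ℕ) :
    n.choose (i + 1) + k * n.choose i ≤ (n + k).choose (i + 1) := by
  induction k with
  | zero => simp
  | succ k ih =>
    rw [← add_assoc, Nat.choose_succ_succ', add_mul, one_mul]
    have := Nat.choose_le_choose i (Nat.le_add_right n k)
    omega

theorem choose_support_sub (n i k : ℕ) :
    (n + k).choose (i + 1) ≤ n.choose (i + 1) + k * (n + k).choose i := by
  induction k with
  | zero => simp
  | succ k ih =>
    rw [← add_assoc, Nat.choose_succ_succ', add_mul, one_mul]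
    have h := Nat.choose_le_choose i (Nat.le_succ (n + k))
    have := Nat.mul_le_mul_left k h
    simp only [Nat.succ_eq_add_one] at this h
    omega

/-- Binomial coefficients are convex in the upper index. -/
theorem choose_support (n n' i : ℕ) :
    (n.choose (i + 1) : ℝ) + ((n' : ℝ) - n) * n.choose i ≤ n'.choose (i + 1) := by
  rcases le_total n n' with h | h
  · obtain ⟨k, rfl⟩ := Nat.exists_eq_add_of_le h
    have := choose_support_add n i k
    have : ((n.choose (i + 1) + k * n.choose i : ℕ) : ℝ) ≤ ((n + k).choose (i + 1) : ℕ) := by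
      exact_mod_cast this
    push_cast at this ⊢
    linarith
  · obtain ⟨k, rfl⟩ := Nat.exists_eq_add_of_le h
    have := choose_support_sub n' i k
    have : (((n' + k).choose (i + 1) : ℕ) : ℝ) ≤
        (n'.choose (i + 1) + k * (n' + k).choose i : ℕ) := by exact_mod_cast this
    push_cast at this ⊢
    linarith

/-- The negative of the slope of a support line of `cutLoad K m` at `t`. -/
noncomputable def cutSlope (K m t : ℕ) : ℝ :=
  ∑ i ∈ range m, ((K - t).choose i : ℝ) / (K.choose (i + 1) : ℝ)

theorem cutSlope_nonneg (K m t : ℕ) : 0 ≤ cutSlope K m t :=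
  sum_nonneg fun _ _ => by positivity

/-- Each summand is convex in `s`, and its support lines add up. As `cutSlope` is nonnegative, an
upper bound on the mean of `s` suffices later. -/
theorem cutLoad_support (K m s t : ℕ) (hs : s ≤ K) (ht : t ≤ K) :
    cutLoad K m t - cutSlope K m t * ((s : ℝ) - t) ≤ cutLoad K m s := by
  unfold cutLoad cutSlope
  rw [sum_mul, ← sum_sub_distrib]
  refine sum_le_sum fun i _ => ?_
  rw [div_mul_eq_mul_div, ← sub_div]
  refine div_le_div_of_nonneg_right ?_ (by positivity)
  have := choose_support (K - t) (K - s) i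
  rw [Nat.cast_sub hs, Nat.cast_sub ht] at this
  linarith

/-- Absorption turns `(K - 1).choose t` and `(K - 1).choose (t - 1)` into `(t + 1) / K * K.choose (t
+ 1)` and `t / K * K.choose t`, while `(K - 1 - m).choose t` is at least `(t + 1) / K * (K -
m).choose (t + 1)`. The ratio to `cutLoad` is thus at most `(t + 1) / t`, and `t = 1` gives the
constant `2`. -/
theorem scheme_le_two_mul_cutLoad (K m t : ℕ) (hm : m ≤ K) (ht : t ∈ Icc 1 K) :
    (((K - 1).choose t : ℝ) - ((K - 1 - m).choose t : ℝ)) / ((K - 1).choose (t - 1) : ℝ)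
      ≤ 2 * cutLoad K m t := by
  rw [mem_Icc] at ht
  obtain ⟨n, rfl⟩ : ∃ n, K = n + 1 := ⟨K - 1, by omega⟩
  obtain ⟨τ, rfl⟩ : ∃ τ, t = τ + 1 := ⟨t - 1, by omega⟩
  have hc1 : (0 : ℝ) < (n.choose τ : ℝ) := by exact_mod_cast Nat.choose_pos (by omega)
  simp only [Nat.add_sub_cancel]
  have h0 := choose_mul_cutLoad (n + 1) m (τ + 1) hm
  have h1 : ((n : ℝ) + 1) * n.choose τ = (n + 1).choose (τ + 1) * (τ + 1) := by
    exact_mod_cast Nat.add_one_mul_choose_eq n τ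
  have h2 : ((n : ℝ) + 1) * n.choose (τ + 1) = (n + 1).choose (τ + 1 + 1) * (τ + 1 + 1) := by
    exact_mod_cast Nat.add_one_mul_choose_eq n (τ + 1)
  have h3 : ((n + 1 - m).choose (τ + 1 + 1) : ℝ) * (τ + 1 + 1) ≤
      ((n : ℝ) + 1) * (n - m).choose (τ + 1) := by
    rcases Nat.lt_or_ge n m with h | h
    · have : n + 1 - m = 0 := by omega
      rw [this]; simp; positivity
    · have h4 : ((n - m : ℕ) + 1 : ℝ) * (n - m).choose (τ + 1)
          = (n - m + 1).choose (τ + 1 + 1) * (τ + 1 + 1) := by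
        exact_mod_cast Nat.add_one_mul_choose_eq (n - m) (τ + 1)
      rw [show n + 1 - m = n - m + 1 by omega, ← h4]
      gcongr
      omega
  have hcut : 0 ≤ cutLoad (n + 1) m (τ + 1) := sum_nonneg fun _ _ => by positivity
  rw [div_le_iff₀ hc1]
  have hn : (0 : ℝ) < (n : ℝ) + 1 := by positivity
  refine le_of_mul_le_mul_left ?_ hn
  have h5 : ((n : ℝ) + 1) * (2 * cutLoad (n + 1) m (τ + 1) * n.choose τ)
      = 2 * (τ + 1) * ((n + 1).choose (τ + 1) * cutLoad (n + 1) m (τ + 1)) := by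
    linear_combination 2 * cutLoad (n + 1) m (τ + 1) * h1
  rw [h5]
  have h6 : 0 ≤ ((n + 1).choose (τ + 1) : ℝ) * cutLoad (n + 1) m (τ + 1) := by positivity
  have h7 : (0 : ℝ) ≤ τ * (((n + 1).choose (τ + 1) : ℝ) * cutLoad (n + 1) m (τ + 1)) := by
    positivity
  nlinarith

/-- Leaving out a user cannot increase the number of distinct requests, so each subtracted binomial
is at least the one with all users counted. -/
theorem schemeLoad_le_two_mul_cutLoad {K N : ℕ} (d : Demand K N) (t : ℕ) (ht : t ∈ Icc 1 K) :
    schemeLoad d t ≤ 2 * cutLoad K (univ.image d).card t := by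
  have hm : (univ.image d).card ≤ K := by simpa using card_image_le (s := univ) (f := d)
  have hK : (0 : ℝ) < K := by
    have := mem_Icc.mp ht
    have : 0 < K := by omega
    positivity
  refine le_trans ?_ (scheme_le_two_mul_cutLoad K _ t hm ht)
  unfold schemeLoad
  refine div_le_div_of_nonneg_right (sub_le_sub_left ?_ _) (by positivity)
  rw [one_div, inv_mul_eq_div, le_div_iff₀ hK]
  calc ((K - 1 - (univ.image d).card).choose t : ℝ) * K
      = ∑ _k : Fin K, ((K - 1 - (univ.image d).card).choose t : ℝ) := by simp [mul_comm]
    _ ≤ _ := by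
        refine sum_le_sum fun k _ => ?_
        have : numDistinctExcept d k ≤ (univ.image d).card :=
          card_le_card (image_subset_image (erase_subset _ _))
        exact_mod_cast Nat.choose_le_choose t (by omega)

theorem schemeWorstAt_le_two_mul_cutLoad (K N t : ℕ) (ht : t ∈ Icc 1 K) :
    schemeWorstAt K N t ≤ 2 * cutLoad K (min N K) t := by
  have hK : (0 : ℝ) < K := by
    have := mem_Icc.mp ht
    have : 0 < K := by omega
    positivity
  have ht' := mem_Icc.mp ht
  refine le_trans ?_ (scheme_le_two_mul_cutLoad K _ t (min_le_right _ _) ht)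
  unfold schemeWorstAt
  split_ifs with h1 h2
  · rw [min_eq_right h1, show K - 1 - K = 0 by omega, Nat.choose_eq_zero_of_lt (by omega : 0 < t)]
    simp
  · rw [min_eq_left (by omega)]
  · push Not at h1 h2
    rw [min_eq_left h1.le, sub_sub]
    refine div_le_div_of_nonneg_right (sub_le_sub_left ?_ _) (by positivity)
    have hle : ((K - 1 - N).choose t : ℝ) ≤ ((K - N).choose t : ℝ) := by
      exact_mod_cast Nat.choose_le_choose t (by omega)
    have h2r : (K : ℝ) ≤ 2 * N := by exact_mod_cast h2.le
    rw [div_mul_eq_mul_div, div_mul_eq_mul_div, ← add_div, le_div_iff₀ hK]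
    nlinarith

/-! ### Symmetrisation over users and files -/

/-- The users that have cached the bit at position `p`. -/
def holders {K N F : ℕ} (Z : Placement K N F) (p : Fin N × Fin F) : Finset (Fin K) :=
  univ.filter fun k => p ∈ Z k

theorem acyclic_le_minLoad {K N F m : ℕ} (hF : 0 < F) (Z : Placement K N F) (d : Demand K N)
    (l : Fin m → Fin K) (hl : Function.Injective (d ∘ l)) :
    ENNReal.ofReal (((∑ i, (univ.filter fun b : Fin F =>
      ∀ j ≤ i, (d (l i), b) ∉ Z (l j)).card : ℕ) : ℝ) / F) ≤ minLoad Z d := by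
  refine le_iInf₂ fun X hX => ?_
  have hF' : (0 : ℝ) < F := by positivity
  rw [ENNReal.ofReal_div_of_pos hF', ENNReal.ofReal_natCast, ENNReal.ofReal_natCast]
  exact ENNReal.div_le_div_right (by exact_mod_cast hX.acyclic_bound l hl) _

/-- The demand vector `d` after a renaming `u` of the users and a shift `c` of the files. -/
def relabel {K N : ℕ} (c : Fin N) (u : Equiv.Perm (Fin K)) (d : Demand K N) : Demand K N :=
  fun k => d (u.symm k) + c

/-- Shifting by `c` makes the requested position run over the whole library; permuting the users
makes the first `i + 1` of them a uniformly random set, which misses the holders of `p` with the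
probability from `sum_perm_disjoint`. -/
theorem sum_acyclic {K N F m : ℕ} [NeZero N] (Z : Placement K N F) (d : Demand K N)
    (l : Fin m → Fin K) (hl : Function.Injective l) :
    ∑ c : Fin N, ∑ u : Equiv.Perm (Fin K), ((∑ i, (univ.filter fun b : Fin F =>
      ∀ j ≤ i, (d (l i) + c, b) ∉ Z (u (l j))).card : ℕ) : ℝ)
      = K.factorial * ∑ p, cutLoad K m (holders Z p).card := by
  classical
  have hmK : m ≤ K := by simpa using Fintype.card_le_of_injective l hl
  have hperm : ∀ (i : Fin m) (p : Fin N × Fin F),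
      (∑ u : Equiv.Perm (Fin K), if ∀ j ≤ i, p ∉ Z (u (l j)) then (1 : ℝ) else 0)
        = K.factorial * (((K - (holders Z p).card).choose (i + 1) : ℝ)
          / (K.choose (i + 1) : ℝ)) := by
    intro i p
    have hI : ((Iic i).image l).card = i + 1 := by
      rw [card_image_of_injective _ hl, Fin.card_Iic]
    have h := sum_perm_disjoint ((Iic i).image l) (holders Z p)
    rw [hI] at h
    have hpos : (K.choose (i + 1) : ℝ) ≠ 0 := by
      have : 0 < K.choose (i + 1) := Nat.choose_pos (by omega)
      positivity
    rw [mul_div_assoc', eq_div_iff hpos]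
    have hcond : ∀ u : Equiv.Perm (Fin K),
        (∀ k ∈ (Iic i).image l, u k ∉ holders Z p) ↔ ∀ j ≤ i, p ∉ Z (u (l j)) := by
      intro u
      simp [holders]
    simp only [hcond] at h
    exact_mod_cast h
  calc ∑ c : Fin N, ∑ u : Equiv.Perm (Fin K), ((∑ i, (univ.filter fun b : Fin F =>
        ∀ j ≤ i, (d (l i) + c, b) ∉ Z (u (l j))).card : ℕ) : ℝ)
      = ∑ i : Fin m, ∑ u : Equiv.Perm (Fin K), ∑ c : Fin N, ∑ b : Fin F,
          if ∀ j ≤ i, (d (l i) + c, b) ∉ Z (u (l j)) then (1 : ℝ) else 0 := by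
        rw [sum_comm]
        simp only [card_filter, Nat.cast_sum, Nat.cast_ite, Nat.cast_one, Nat.cast_zero]
        refine Eq.trans (sum_congr rfl fun u _ => ?_) sum_comm
        exact sum_comm
    _ = ∑ i : Fin m, ∑ u : Equiv.Perm (Fin K), ∑ p : Fin N × Fin F,
          if ∀ j ≤ i, p ∉ Z (u (l j)) then (1 : ℝ) else 0 := by
        refine sum_congr rfl fun i _ => sum_congr rfl fun u _ => ?_
        rw [Fintype.sum_prod_type]
        exact Equiv.sum_comp (Equiv.addLeft (d (l i))) (fun n => ∑ b : Fin F,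
          if ∀ j ≤ i, (n, b) ∉ Z (u (l j)) then (1 : ℝ) else 0)
    _ = ∑ p : Fin N × Fin F, ∑ i : Fin m, K.factorial *
          (((K - (holders Z p).card).choose (i + 1) : ℝ) / (K.choose (i + 1) : ℝ)) := by
        refine Eq.trans (sum_congr rfl fun i _ => ?_) sum_comm
        rw [sum_comm]
        exact sum_congr rfl fun p _ => hperm i p
    _ = _ := by
        rw [mul_sum]
        refine sum_congr rfl fun p _ => ?_
        rw [← mul_sum, cutLoad, ← Fin.sum_univ_eq_sum_range (fun i =>
          ((K - (holders Z p).card).choose (i + 1) : ℝ) / (K.choose (i + 1) : ℝ))]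

theorem le_sum_minLoad_relabel {K N F m : ℕ} [NeZero N] (hF : 0 < F) (Z : Placement K N F)
    (d : Demand K N) (l : Fin m → Fin K) (hl : Function.Injective (d ∘ l)) :
    ENNReal.ofReal (K.factorial * (∑ p, cutLoad K m (holders Z p).card) / F)
      ≤ ∑ c : Fin N, ∑ u : Equiv.Perm (Fin K), minLoad Z (relabel c u d) := by
  rw [← sum_acyclic Z d l hl.of_comp, sum_div, ENNReal.ofReal_sum_of_nonneg fun c _ => by positivity]
  refine sum_le_sum fun c _ => ?_
  rw [sum_div, ENNReal.ofReal_sum_of_nonneg fun u _ => by positivity]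
  refine sum_le_sum fun u _ => ?_
  have hinj : Function.Injective (relabel c u d ∘ (u ∘ l)) := by
    intro i i' h
    apply hl
    simpa [relabel] using h
  have := acyclic_le_minLoad hF Z (relabel c u d) (u ∘ l) hinj
  simpa [relabel] using this

theorem sum_card_holders {K N F : ℕ} (Z : Placement K N F) :
    ∑ p, (holders Z p).card = ∑ k, (Z k).card := by
  simp only [holders, card_filter]
  rw [sum_comm]
  refine sum_congr rfl fun k _ => ?_
  rw [← card_filter, filter_mem_eq_inter, univ_inter]

/-- The distribution of the number of users that have cached a uniformly chosen bit. -/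
theorem exists_weights_of_placement {K N F : ℕ} {M : ℝ} (hN : 0 < N) (hF : 0 < F)
    (Z : Placement K N F) (hZ : Z.FitsMemory M) (hcov : ∀ p, ∃ k, p ∈ Z k) :
    ∃ w : ℕ → ℝ, (∀ s, 0 ≤ w s) ∧ ∑ s ∈ Icc 1 K, w s = 1 ∧
      ∑ s ∈ Icc 1 K, w s * (s : ℝ) ≤ K * M / N ∧
      ∀ φ : ℕ → ℝ, (∑ p, φ (holders Z p).card) / (N * F) = ∑ s ∈ Icc 1 K, w s * φ s := by
  classical
  have hNr : (0 : ℝ) < N := by positivity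
  have hFr : (0 : ℝ) < F := by positivity
  set w : ℕ → ℝ := fun s => ((univ.filter fun p => (holders Z p).card = s).card : ℝ) / (N * F)
    with hw
  have hmaps : ∀ p ∈ (univ : Finset (Fin N × Fin F)), (holders Z p).card ∈ Icc 1 K := by
    intro p _
    obtain ⟨k, hk⟩ := hcov p
    rw [mem_Icc]
    exact ⟨card_pos.mpr ⟨k, by simp [holders, hk]⟩, by simpa using card_le_univ (holders Z p)⟩
  have hφ : ∀ φ : ℕ → ℝ, (∑ p, φ (holders Z p).card) / (N * F) = ∑ s ∈ Icc 1 K, w s * φ s := by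
    intro φ
    rw [← sum_fiberwise_of_maps_to hmaps, sum_div]
    refine sum_congr rfl fun s _ => ?_
    rw [sum_congr rfl fun p hp => congrArg φ (mem_filter.mp hp).2, sum_const, nsmul_eq_mul, hw]
    ring
  refine ⟨w, fun s => by positivity, ?_, ?_, hφ⟩
  · have := hφ (fun _ => 1)
    simp only [mul_one] at this
    rw [← this]
    simp only [sum_const, card_univ, Fintype.card_prod, Fintype.card_fin, nsmul_eq_mul, mul_one]
    push_cast
    field_simp
  · rw [← hφ (fun s => (s : ℝ)), ← Nat.cast_sum, sum_card_holders, Nat.cast_sum, div_le_div_iff₀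
      (by positivity) hNr]
    have h : ∑ k, ((Z k).card : ℝ) ≤ K * (M * F) := by
      calc ∑ k, ((Z k).card : ℝ) ≤ ∑ _k : Fin K, M * F := sum_le_sum fun k _ => hZ k
        _ = _ := by simp
    nlinarith

/-! ### From the distribution of holders to the scheme's load -/

/-- A convex function `f` that is at least half of `r` at the integers bounds the extension of
`r`, also for convex combinations with a smaller abscissa. -/
theorem extendByEnvelope_le (K : ℕ) (r f g w : ℕ → ℝ) (x : ℝ) (hr : ∀ s ∈ Icc 1 K, 0 ≤ r s)
    (hrK : r K = 0) (hrf : ∀ s ∈ Icc 1 K, r s ≤ 2 * f s) (hg : ∀ t, 0 ≤ g t)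
    (hfg : ∀ s ∈ Icc 1 K, ∀ t ∈ Icc 1 K, f t - g t * ((s : ℝ) - t) ≤ f s)
    (hx1 : 1 ≤ x) (hxK : x < K) (hw : ∀ s, 0 ≤ w s) (hw1 : ∑ s ∈ Icc 1 K, w s = 1)
    (hwx : ∑ s ∈ Icc 1 K, w s * (s : ℝ) ≤ x) :
    extendByEnvelope K r x ≤ 2 * ∑ s ∈ Icc 1 K, w s * f s := by
  unfold extendByEnvelope
  split_ifs with hx
  · have ht : ⌊x⌋₊ ∈ Icc 1 K :=
      mem_Icc.mpr ⟨(Nat.one_le_floor_iff x).mpr hx1, Nat.floor_le_of_le hxK.le⟩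
    set t := ⌊x⌋₊
    refine (hrf t ht).trans ?_
    -- Jensen's inequality for `f` through its support line at `t = x`; convexity of `r` itself is
    -- not needed.
    have h1 : ∑ s ∈ Icc 1 K, w s * (f t - g t * ((s : ℝ) - t)) ≤ ∑ s ∈ Icc 1 K, w s * f s :=
      sum_le_sum fun s hs => mul_le_mul_of_nonneg_left (hfg s hs t ht) (hw s)
    have h2 : ∑ s ∈ Icc 1 K, w s * (f t - g t * ((s : ℝ) - t))
        = (f t + g t * t) * ∑ s ∈ Icc 1 K, w s - g t * ∑ s ∈ Icc 1 K, w s * (s : ℝ) := by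
      rw [mul_sum, mul_sum, ← sum_sub_distrib]
      exact sum_congr rfl fun s _ => by ring
    rw [h2, hw1] at h1
    have := mul_le_mul_of_nonneg_left hwx (hg t)
    rw [hx] at this
    linarith
  · set μ := ∑ s ∈ Icc 1 K, w s * (s : ℝ) with hμ
    have hKm : K ∈ Icc 1 K :=
      mem_Icc.mpr ⟨by exact_mod_cast (hx1.trans hxK.le), le_rfl⟩
    have hd : 0 < (K : ℝ) - μ := by linarith
    -- The share `θ` of the mass, moved to `K`, raises the abscissa from `μ` to `x`; it costs
    -- nothing because `r K = 0`.
    set θ := (x - μ) / (K - μ) with hθ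
    have hθ0 : 0 ≤ θ := div_nonneg (by linarith) hd.le
    have hθ1 : θ ≤ 1 := (div_le_one hd).mpr (by linarith)
    have hgen : ∀ φ : ℕ → ℝ, ∑ s ∈ Icc 1 K, ((1 - θ) * w s + if s = K then θ else 0) * φ s
        = (1 - θ) * ∑ s ∈ Icc 1 K, w s * φ s + θ * φ K := by
      intro φ
      simp only [add_mul, ite_mul, zero_mul, mul_assoc]
      rw [sum_add_distrib, sum_ite_eq', if_pos hKm, mul_sum]
    have hwr : 0 ≤ ∑ s ∈ Icc 1 K, w s * r s :=
      sum_nonneg fun s hs => mul_nonneg (hw s) (hr s hs)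
    calc lowerConvexEnvelope K r x
        ≤ ∑ s ∈ Icc 1 K, ((1 - θ) * w s + if s = K then θ else 0) * r s := by
          unfold lowerConvexEnvelope
          refine csInf_le ⟨0, ?_⟩ ⟨fun s => (1 - θ) * w s + if s = K then θ else 0, ?_, ?_, ?_, rfl⟩
          · rintro y ⟨v, hv, -, -, rfl⟩
            exact sum_nonneg fun s hs => mul_nonneg (hv s hs) (hr s hs)
          · intro s _
            have := mul_nonneg (sub_nonneg.mpr hθ1) (hw s)
            positivity
          · have := hgen (fun _ => 1)
            simp only [mul_one] at this
            rw [this, hw1]; ring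
          · rw [hgen (fun s => (s : ℝ)), ← hμ, hθ]
            field_simp
            ring
      _ = (1 - θ) * ∑ s ∈ Icc 1 K, w s * r s := by rw [hgen, hrK]; ring
      _ ≤ ∑ s ∈ Icc 1 K, w s * r s := by nlinarith
      _ ≤ ∑ s ∈ Icc 1 K, w s * (2 * f s) :=
          sum_le_sum fun s hs => mul_le_mul_of_nonneg_left (hrf s hs) (hw s)
      _ = _ := by
          rw [mul_sum]
          exact sum_congr rfl fun s _ => by ring

/-! ### Lower bounds on the optimum and conclusion -/

theorem ofReal_le_of_natCast_mul {n : ℕ} (hn : 0 < n) {y : ℝ} {G : ℝ≥0∞}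
    (h : ENNReal.ofReal (n * y) ≤ n * G) : ENNReal.ofReal y ≤ G := by
  rw [ENNReal.ofReal_mul (by positivity), ENNReal.ofReal_natCast] at h
  exact (ENNReal.mul_le_mul_iff_right (by positivity) (ENNReal.natCast_ne_top n)).mp h

/-- Relabelling permutes the demand vectors, so averaging over it leaves the uniform average
unchanged. -/
theorem sum_relabel {K N : ℕ} [NeZero N] (c : Fin N) (u : Equiv.Perm (Fin K))
    (G : Demand K N → ℝ≥0∞) : ∑ d, G (relabel c u d) = ∑ d, G d :=
  Equiv.sum_comp (Equiv.arrowCongr u (Equiv.addRight c)) G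

theorem exists_leader_enumeration {K N : ℕ} (d : Demand K N) :
    ∃ l : Fin (univ.image d).card → Fin K, Function.Injective (d ∘ l) := by
  classical
  have h : ∀ i, ∃ k, d k = (((univ.image d).equivFin.symm i : (univ.image d)) : Fin N) := by
    intro i
    obtain ⟨k, -, hk⟩ := mem_image.mp ((univ.image d).equivFin.symm i).2
    exact ⟨k, hk⟩
  choose l hl using h
  refine ⟨l, fun i i' hii => ?_⟩
  simp only [Function.comp, hl] at hii
  exact (univ.image d).equivFin.symm.injective (Subtype.ext hii)

theorem le_sum_minLoad {K N F : ℕ} (hN : 0 < N) (hF : 0 < F) (Z : Placement K N F) :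
    ENNReal.ofReal (∑ d : Demand K N,
      (∑ p, cutLoad K (univ.image d).card (holders Z p).card) / (N * F)) ≤ ∑ d, minLoad Z d := by
  have : NeZero N := ⟨hN.ne'⟩
  have hNr : (0 : ℝ) < N := by positivity
  have hFr : (0 : ℝ) < F := by positivity
  have hcut : ∀ m s, 0 ≤ cutLoad K m s := fun m s => sum_nonneg fun _ _ => by positivity
  refine ofReal_le_of_natCast_mul (n := N * K.factorial) (by positivity) ?_
  have e : (((N * K.factorial : ℕ)) : ℝ) * ∑ d : Demand K N,
      (∑ p, cutLoad K (univ.image d).card (holders Z p).card) / (N * F)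
      = ∑ d : Demand K N, K.factorial *
        (∑ p, cutLoad K (univ.image d).card (holders Z p).card) / F := by
    rw [mul_sum]
    refine sum_congr rfl fun d _ => ?_
    push_cast
    field_simp
  rw [e, ENNReal.ofReal_sum_of_nonneg fun d _ => div_nonneg (mul_nonneg (by positivity)
    (sum_nonneg fun p _ => hcut _ _)) hFr.le]
  calc _ ≤ ∑ d : Demand K N, ∑ c : Fin N, ∑ u : Equiv.Perm (Fin K), minLoad Z (relabel c u d) := by
        refine sum_le_sum fun d _ => ?_
        obtain ⟨l, hl⟩ := exists_leader_enumeration d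
        exact le_sum_minLoad_relabel hF Z d l hl
    _ = ∑ c : Fin N, ∑ u : Equiv.Perm (Fin K), ∑ d : Demand K N, minLoad Z (relabel c u d) := by
        rw [sum_comm]
        exact sum_congr rfl fun c _ => sum_comm
    _ = _ := by
        simp only [sum_relabel, sum_const, card_univ, Fintype.card_perm, Fintype.card_fin,
          nsmul_eq_mul]
        push_cast
        ring

theorem exists_demand_distinct (K N : ℕ) (hN : 0 < N) :
    ∃ (d : Demand K N) (l : Fin (min N K) → Fin K), Function.Injective (d ∘ l) := by
  refine ⟨fun k => ⟨k % N, Nat.mod_lt _ hN⟩, Fin.castLE (min_le_right _ _), fun i i' h => ?_⟩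
  have hi : (i : ℕ) < N := i.2.trans_le (min_le_left _ _)
  have hi' : (i' : ℕ) < N := i'.2.trans_le (min_le_left _ _)
  have := congrArg Fin.val h
  simp only [Function.comp, Fin.val_castLE, Nat.mod_eq_of_lt hi, Nat.mod_eq_of_lt hi'] at this
  exact Fin.ext this

theorem le_iSup_minLoad {K N F : ℕ} (hN : 0 < N) (hF : 0 < F) (Z : Placement K N F) :
    ENNReal.ofReal ((∑ p, cutLoad K (min N K) (holders Z p).card) / (N * F))
      ≤ ⨆ d, minLoad Z d := by
  have : NeZero N := ⟨hN.ne'⟩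
  have hNr : (0 : ℝ) < N := by positivity
  have hFr : (0 : ℝ) < F := by positivity
  refine ofReal_le_of_natCast_mul (n := N * K.factorial) (by positivity) ?_
  have e : (((N * K.factorial : ℕ)) : ℝ) *
      ((∑ p, cutLoad K (min N K) (holders Z p).card) / (N * F))
      = K.factorial * (∑ p, cutLoad K (min N K) (holders Z p).card) / F := by
    push_cast
    field_simp
  obtain ⟨d, l, hl⟩ := exists_demand_distinct K N hN
  rw [e]
  refine (le_sum_minLoad_relabel hF Z d l hl).trans ?_
  calc _ ≤ ∑ _c : Fin N, ∑ _u : Equiv.Perm (Fin K), ⨆ d, minLoad Z d :=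
        sum_le_sum fun c _ => sum_le_sum fun u _ => le_iSup (minLoad Z) _
    _ = _ := by
        simp only [sum_const, card_univ, Fintype.card_perm, Fintype.card_fin, nsmul_eq_mul]
        push_cast
        ring

theorem schemeAveAt_self {K N : ℕ} (hK : 0 < K) : schemeAveAt K N K = 0 := by
  have h : ∀ n, n ≤ K - 1 → n.choose K = 0 := fun n hn => Nat.choose_eq_zero_of_lt (by omega)
  simp [schemeAveAt, schemeLoad, h (K - 1) le_rfl, h _ (Nat.sub_le (K - 1) _)]

theorem schemeWorstAt_self {K N : ℕ} (hK : 0 < K) (hN : 0 < N) : schemeWorstAt K N K = 0 := by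
  have h : ∀ n, n ≤ K - 1 → n.choose K = 0 := fun n hn => Nat.choose_eq_zero_of_lt (by omega)
  simp [schemeWorstAt, h (K - 1) le_rfl, h _ (Nat.sub_le (K - 1) _), h (K - N) (by omega)]

/-- A placement that leaves some bit uncached has infinite load. Otherwise `extendByEnvelope_le` is
applied to the mean of `cutLoad` over the demands, which inherits support lines and the factor two
termwise. -/
theorem schemeAve_le_two_mul_optAve (K N : ℕ) (M : ℝ) (hK : 0 < K) (hN : 0 < N)
    (hx1 : 1 ≤ K * M / N) (hxK : K * M / N < K) :
    ENNReal.ofReal (schemeAve K N M) ≤ 2 * optAve K N M := by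
  have hNK : (0 : ℝ) < (N : ℝ) ^ K := by positivity
  unfold optAve
  simp only [ENNReal.mul_iInf_of_ne two_ne_zero ENNReal.ofNat_ne_top]
  refine le_iInf₂ fun F hF => le_iInf₂ fun Z hZ => ?_
  by_cases hcov : ∀ p, ∃ k, p ∈ Z k
  · obtain ⟨w, hw, hw1, hwx, hwφ⟩ := exists_weights_of_placement hN hF Z hZ hcov
    set f : ℕ → ℝ := fun s => (∑ d : Demand K N, cutLoad K (univ.image d).card s) / (N : ℝ) ^ K
      with hf
    have hmain := extendByEnvelope_le K (schemeAveAt K N) f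
      (fun t => (∑ d : Demand K N, cutSlope K (univ.image d).card t) / (N : ℝ) ^ K) w _
      (schemeAveAt_nonneg hK) (schemeAveAt_self hK)
      (fun s hs => by
        rw [hf, schemeAveAt, mul_div_assoc', mul_sum]
        exact div_le_div_of_nonneg_right
          (sum_le_sum fun d _ => schemeLoad_le_two_mul_cutLoad d s hs) hNK.le)
      (fun t => div_nonneg (sum_nonneg fun d _ => cutSlope_nonneg _ _ _) hNK.le)
      (fun s hs t ht => by
        rw [hf]
        simp only
        rw [div_mul_eq_mul_div, ← sub_div, sum_mul, ← sum_sub_distrib]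
        exact div_le_div_of_nonneg_right (sum_le_sum fun d _ => cutLoad_support _ _ _ _
          (mem_Icc.mp hs).2 (mem_Icc.mp ht).2) hNK.le)
      hx1 hxK hw hw1 hwx
    have hsum := le_sum_minLoad hN hF Z
    simp only [hwφ] at hsum
    have e : ∑ s ∈ Icc 1 K, w s * f s = (∑ d : Demand K N, ∑ s ∈ Icc 1 K,
        w s * cutLoad K (univ.image d).card s) / (N : ℝ) ^ K := by
      rw [sum_comm, sum_div]
      refine sum_congr rfl fun s _ => ?_
      rw [hf, ← mul_sum, mul_div_assoc]
    refine (ENNReal.ofReal_le_ofReal hmain).trans ?_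
    rw [ENNReal.ofReal_mul two_pos.le, ENNReal.ofReal_ofNat, e, ENNReal.ofReal_div_of_pos hNK,
      ENNReal.ofReal_pow (by positivity), ENNReal.ofReal_natCast]
    gcongr
  · push Not at hcov
    obtain ⟨p, hp⟩ := hcov
    have : ∑ d, minLoad Z d = ⊤ :=
      ENNReal.sum_eq_top.mpr ⟨fun _ => p.1, mem_univ _, minLoad_eq_top hK Z p hp⟩
    rw [this, ENNReal.top_div_of_ne_top (by finiteness), ENNReal.mul_top two_ne_zero]
    exact le_top

theorem schemeWorst_le_two_mul_optWorst (K N : ℕ) (M : ℝ) (hK : 0 < K) (hN : 0 < N)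
    (hx1 : 1 ≤ K * M / N) (hxK : K * M / N < K) :
    ENNReal.ofReal (schemeWorst K N M) ≤ 2 * optWorst K N M := by
  unfold optWorst
  simp only [ENNReal.mul_iInf_of_ne two_ne_zero ENNReal.ofNat_ne_top]
  refine le_iInf₂ fun F hF => le_iInf₂ fun Z hZ => ?_
  by_cases hcov : ∀ p, ∃ k, p ∈ Z k
  · obtain ⟨w, hw, hw1, hwx, hwφ⟩ := exists_weights_of_placement hN hF Z hZ hcov
    have hmain := extendByEnvelope_le K (schemeWorstAt K N) (cutLoad K (min N K))
      (cutSlope K (min N K)) w _ (schemeWorstAt_nonneg hK hN) (schemeWorstAt_self hK hN)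
      (fun s hs => schemeWorstAt_le_two_mul_cutLoad K N s hs)
      (cutSlope_nonneg _ _)
      (fun s hs t ht => cutLoad_support _ _ _ _ (mem_Icc.mp hs).2 (mem_Icc.mp ht).2)
      hx1 hxK hw hw1 hwx
    have hsup := le_iSup_minLoad hN hF Z
    rw [hwφ] at hsup
    refine (ENNReal.ofReal_le_ofReal hmain).trans ?_
    rw [ENNReal.ofReal_mul two_pos.le, ENNReal.ofReal_ofNat]
    gcongr
  · push Not at hcov
    obtain ⟨p, hp⟩ := hcov
    have : ⨆ d, minLoad Z d = ⊤ :=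
      top_le_iff.mp ((minLoad_eq_top hK Z p hp).symm.trans_le (le_iSup (minLoad Z) _))
    rw [this, ENNReal.mul_top two_ne_zero]
    exact le_top

theorem minLoad_le_minLoadOneShot {K N F : ℕ} (Z : Placement K N F) (d : Demand K N) :
    minLoad Z d ≤ minLoadOneShot Z d :=
  le_iInf₂ fun X hX => iInf₂_le X hX.1

theorem optAve_le_optAveOneShot (K N : ℕ) (M : ℝ) : optAve K N M ≤ optAveOneShot K N M :=
  iInf₂_mono fun _ _ => iInf₂_mono fun Z _ =>
    ENNReal.div_le_div_right (sum_le_sum fun d _ => minLoad_le_minLoadOneShot Z d) _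

theorem optWorst_le_optWorstOneShot (K N : ℕ) (M : ℝ) :
    optWorst K N M ≤ optWorstOneShot K N M :=
  iInf₂_mono fun _ _ => iInf₂_mono fun Z _ => iSup_mono fun d => minLoad_le_minLoadOneShot Z d

end D2DCaching

theorem theorem3 (K N : ℕ) (M : ℝ) (hK : 0 < K) (hN : 0 < N)
    (hM : (N : ℝ) / (K : ℝ) ≤ M) (hM' : M < (N : ℝ)) :
    (D2DCaching.optAve K N M ≤ D2DCaching.optAveOneShot K N M ∧
      D2DCaching.optAveOneShot K N M ≤ ENNReal.ofReal (D2DCaching.schemeAve K N M) ∧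
      ENNReal.ofReal (D2DCaching.schemeAve K N M) ≤ 2 * D2DCaching.optAve K N M) ∧
    (D2DCaching.optWorst K N M ≤ D2DCaching.optWorstOneShot K N M ∧
      D2DCaching.optWorstOneShot K N M ≤ ENNReal.ofReal (D2DCaching.schemeWorst K N M) ∧
      ENNReal.ofReal (D2DCaching.schemeWorst K N M) ≤ 2 * D2DCaching.optWorst K N M) := by
  have hKr : (0 : ℝ) < K := by positivity
  have hNr : (0 : ℝ) < N := by positivity
  have hx1 : 1 ≤ K * M / N := by
    rw [div_le_iff₀ hKr] at hM
    rw [le_div_iff₀ hNr]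
    linarith
  have hxK : K * M / N < K := by
    rw [div_lt_iff₀ hNr]
    exact mul_lt_mul_of_pos_left hM' hKr
  exact ⟨⟨D2DCaching.optAve_le_optAveOneShot K N M,
    D2DCaching.le_ofReal_extendByEnvelope K _ _ (D2DCaching.schemeAveAt_nonneg hK) hx1 hxK _
      (D2DCaching.optAveOneShot_le_of_weights K N M hK hN),
    D2DCaching.schemeAve_le_two_mul_optAve K N M hK hN hx1 hxK⟩,
    ⟨D2DCaching.optWorst_le_optWorstOneShot K N M,
    D2DCaching.le_ofReal_extendByEnvelope K _ _ (D2DCaching.schemeWorstAt_nonneg hK hN) hx1 hxK _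
      (D2DCaching.optWorstOneShot_le_of_weights K N M hK hN),
    D2DCaching.schemeWorst_le_two_mul_optWorst K N M hK hN hx1 hxK⟩⟩
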